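/- Let $\mathbf{k}$ be an algebraically closed field of characteristic zero, $C$ a smooth affine algebraic curve over $\mathbf{k}$, $N=\mathbb{Z}^n$ a lattice ($n\ge 0$) with dual lattice $M$, and $\sigma\subset N_{\mathbb{Q}}$ a pointed (strongly convex) polyhedral cone with dual cone $\sigma^\vee\subset M_{\mathbb{Q}}$. A *$\sigma$-polyhedron* is a Minkowski sum $Q+\sigma$ with $Q$ a nonempty polytope; its support function is $h_\Delta(m)=\min_{v\in\Delta}m(v)$, $m\in\sigma^\vee$. Let $\mathfrak{D}=\sum_{z\in C}\Delta_z\cdot z$ be a $\sigma$-polyhedral divisor on $C$: each $\Delta_z$ is a $\sigma$-polyhedron, and the support $\{z:\Delta_z\ne\sigma\}$ is finite. Put $\mathfrak{D}(m)=\sum_z h_{\Delta_z}(m)\cdot z$ and $$A=A[C,\mathfrak{D}]=\bigoplus_{m\in\sigma^\vee\cap M}H^0(C,\mathcal{O}_C(\lfloor\mathfrak{D}(m)\rfloor))\chi^m\subset\mathbf{k}(C)[M].$$ An element $a$ of a ring is integral over an ideal $J$ if $a^r+\lambda_1a^{r-1}+\dots+\lambda_r=0$ for some $r\ge1$ and $\lambda_i\in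 J^i$; the integral closure $\overline{J}$ is the ideal of all such $a$; $J$ is integrally closed if $\overline J=J$, and normal if $J^e$ is integrally closed for every $e\ge1$. A lattice polyhedron $P$ is normal if for every $e\ge1$ the lattice points of $eP$ are exactly the sums of $e$ lattice points of $P$. Let $I\subset A$ be a homogeneous (nonzero and generated by homogeneous elements $f\chi^m$) integrally closed ideal. Its associated pair $(P,\widetilde{\mathfrak{D}})$, $\widetilde{\mathfrak{D}}=\sum_z\widetilde\Delta_z\cdot z$, is characterized by the following conditions. * $P$ is the sum of $\sigma^\vee$ and a nonempty polytope with vertices in $\sigma^\vee\cap M$. * $\widetilde{\mathfrak{D}}$ is an $\widetilde\omega^\vee$-polyhedral divisor on $C$ (with coefficients in $N_{\mathbb{Q}}\times\mathbb{Q}$), where $\widetilde\omega=\{(m,e)\in M_{\mathbb{Q}}\times\mathbb{Q} : e\ge0,\ m\in eP\}$, with the convention $0P=\sigma^\vee$. * For every $z\in C$, the projection of $\widetilde\Delta_z$ to $N_{\mathbb{Q}}$ is $\Delta_z$, and every vertex $(v,p)$ of $\widetilde\Delta_z$ satisfies $p\le0$. * For every $z\in C$, $\widetilde\Delta_z$ is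 the intersection of $\Delta_z\times\mathbb{Q}$ with finitely many half-spaces $\{(v,p): m(v)+p\ge e\}$ with $m\in P\cap M$, $e\in\mathbb{Z}$. * $I=\bigoplus_{m\in P\cap M}H^0(C,\mathcal{O}_C(\lfloor\widetilde{\mathfrak{D}}(m,1)\rfloor))\chi^m$. For $z\in C$ let $\widetilde P_z\subset M_{\mathbb{Q}}\times\mathbb{Q}$ be the lattice polyhedron $$\widetilde P_z=\mathrm{Conv}\{(m,i)\in(P\cap M)\times\mathbb{Z} : h_{\widetilde\Delta_z}(m,1)\ge-i\}.$$ Then the following hold. 1. If $\widetilde P_z$ is normal for every $z$ in the support of $\widetilde{\mathfrak{D}}$ (and, in case this support is empty, if $P$ is normal), then $I$ is normal. 2. For every integer $e\ge n=\dim N_{\mathbb{Q}}$, the ideal $\overline{I^e}$ is normal. 3. In particular, let $X=\mathrm{Spec}\,B$ be a normal affine surface over $\mathbf{k}$ with a faithful algebraic action of $\mathbf{k}^*$ that is not elliptic, i.e. whose ring of invariants is not $\mathbf{k}$. Then every $\mathbf{k}^*$-stable integrally closed ideal of $B$ is normal. -/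

import Mathlib

open scoped Pointwise

noncomputable section

namespace ComplexityOne

/-! ### Integral closure of ideals -/

section IntegralClosure

variable {A : Type*} [CommRing A]

/-- `a` is integral over the ideal `I`:
`a ^ r + l₁ a ^ (r - 1) + ⋯ + l_r = 0` with `r ≥ 1` and `l_i ∈ I ^ i`. -/
def IsIntegralOverIdeal (I : Ideal A) (a : A) : Prop :=
  ∃ r : ℕ, 1 ≤ r ∧ ∃ l : ℕ → A, (∀ i ∈ Finset.Icc 1 r, l i ∈ I ^ i) ∧
    a ^ r + ∑ i ∈ Finset.Icc 1 r, l i * a ^ (r - i) = 0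

theorem isIntegralOverIdeal_iff (I : Ideal A) (a : A) :
    IsIntegralOverIdeal I a ↔
      IsIntegral (reesAlgebra I) (Polynomial.monomial 1 a : Polynomial A) := by
  classical
  constructor
  · rintro ⟨r, hr, l, hl, h⟩
    have hmem : ∀ i ∈ Finset.Icc 1 r, Polynomial.monomial i (l i) ∈ reesAlgebra I :=
      fun i hi => reesAlgebra.monomial_mem.mpr (hl i hi)
    let c : ℕ → reesAlgebra I := fun i =>
      if hi : i ∈ Finset.Icc 1 r then ⟨Polynomial.monomial i (l i), hmem i hi⟩ else 0
    let q : Polynomial (reesAlgebra I) :=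
      ∑ i ∈ Finset.Icc 1 r, Polynomial.monomial (r - i) (c i)
    refine ⟨Polynomial.X ^ r + q, Polynomial.monic_X_pow_add ?_, ?_⟩
    · refine (Polynomial.degree_sum_le _ _).trans_lt ?_
      rw [Finset.sup_lt_iff (by exact_mod_cast WithBot.bot_lt_coe r)]
      intro i hi
      refine (Polynomial.degree_monomial_le _ _).trans_lt ?_
      have := Finset.mem_Icc.mp hi
      exact_mod_cast (by omega : r - i < r)
    · rw [Polynomial.eval₂_add, Polynomial.eval₂_X_pow, Polynomial.eval₂_finsetSum]
      have key : ∀ i ∈ Finset.Icc 1 r,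
          Polynomial.eval₂ (algebraMap (reesAlgebra I) (Polynomial A))
            (Polynomial.monomial 1 a) (Polynomial.monomial (r - i) (c i))
          = Polynomial.monomial r (l i * a ^ (r - i)) := by
        intro i hi
        have h2 := Finset.mem_Icc.mp hi
        rw [Polynomial.eval₂_monomial, Polynomial.monomial_pow]
        have hc : algebraMap (reesAlgebra I) (Polynomial A) (c i)
            = Polynomial.monomial i (l i) := by
          simp only [c, dif_pos hi]
          rfl
        rw [hc, Polynomial.monomial_mul_monomial]
        congr 2
        omega
      rw [Finset.sum_congr rfl key, Polynomial.monomial_pow, one_mul, ← map_sum, ← map_add, h,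
        map_zero]
  · rintro ⟨p, hp, h⟩
    rcases subsingleton_or_nontrivial A with hA | hA
    · exact ⟨1, le_rfl, 0, fun _ _ => Submodule.zero_mem _, Subsingleton.elim _ _⟩
    have hdeg : 1 ≤ p.natDegree := by
      by_contra h0
      have h0' : p.natDegree = 0 := by omega
      have : p = 1 := hp.natDegree_eq_zero.mp h0'
      rw [this, Polynomial.eval₂_one] at h
      exact one_ne_zero h
    refine ⟨p.natDegree, hdeg, fun i => ((p.coeff (p.natDegree - i) : reesAlgebra I) :
      Polynomial A).coeff i, fun i _ => (p.coeff (p.natDegree - i)).2 i, ?_⟩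
    have h1 := congrArg (fun f : Polynomial A => f.coeff p.natDegree) h
    simp only [Polynomial.eval₂_eq_sum_range, Polynomial.finsetSum_coeff,
      Polynomial.coeff_zero] at h1
    rw [← h1, Finset.sum_range_succ, add_comm]
    congr 1
    · refine Finset.sum_bij' (fun i _ => p.natDegree - i) (fun i _ => p.natDegree - i)
        ?_ ?_ ?_ ?_ ?_
      · intro i hi
        have := Finset.mem_Icc.mp hi
        simp only [Finset.mem_range]; omega
      · intro i hi
        have := Finset.mem_range.mp hi
        simp only [Finset.mem_Icc]; omega
      · intro i hi
        have := Finset.mem_Icc.mp hi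
        omega
      · intro i hi
        have := Finset.mem_range.mp hi
        omega
      · intro i hi
        have h2 := Finset.mem_Icc.mp hi
        rw [Polynomial.monomial_pow, one_mul]
        conv_rhs => rw [show p.natDegree = i + (p.natDegree - i) by omega]
        rw [show i + (p.natDegree - i) - i = p.natDegree - i by omega,
          Polynomial.coeff_mul_monomial]
        rfl
    · rw [Polynomial.monomial_pow, one_mul, hp.coeff_natDegree]
      simp

/-- The integral closure of the ideal `I` in `A`. -/
def idealClosure (I : Ideal A) : Ideal A where
  carrier := {a | IsIntegralOverIdeal I a}
  zero_mem' := by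
    simp only [Set.mem_ofPred_eq, isIntegralOverIdeal_iff, map_zero]
    exact isIntegral_zero
  add_mem' {a b} ha hb := by
    simp only [Set.mem_ofPred_eq, isIntegralOverIdeal_iff, map_add] at ha hb ⊢
    exact ha.add hb
  smul_mem' c a ha := by
    simp only [Set.mem_ofPred_eq, isIntegralOverIdeal_iff] at ha ⊢
    have hc : IsIntegral (reesAlgebra I) (Polynomial.C c : Polynomial A) :=
      isIntegral_algebraMap (R := reesAlgebra I) (x := algebraMap A (reesAlgebra I) c)
    have := hc.mul ha
    rwa [Polynomial.C_mul_monomial] at this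

/-- `I` is integrally closed (complete). -/
def IsIntegrallyClosedIdeal (I : Ideal A) : Prop :=
  ∀ a, IsIntegralOverIdeal I a → a ∈ I

/-- `I` is normal: all its positive powers are integrally closed. -/
def IsNormalIdeal (I : Ideal A) : Prop :=
  ∀ e : ℕ, 1 ≤ e → IsIntegrallyClosedIdeal (I ^ e)

end IntegralClosure

/-! ### Convex geometry in `ℚ^ι`, with the lattice `ℤ^ι` and the pairing `m ⬝ᵥ v` -/

section Convex

variable {ι : Type*} [Fintype ι]

/-- The inclusion of the lattice `ℤ^ι` in `ℚ^ι`. -/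
def castQ (m : ι → ℤ) : ι → ℚ := fun i => (m i : ℚ)

/-- The dual cone `{m | ∀ v ∈ s, 0 ≤ m(v)}`. -/
def dualCone (s : Set (ι → ℚ)) : PointedCone ℚ (ι → ℚ) :=
  PointedCone.dual (dotProductBilin ℚ ℚ) s

theorem mem_dualCone {s : Set (ι → ℚ)} {m : ι → ℚ} :
    m ∈ dualCone s ↔ ∀ v ∈ s, 0 ≤ m ⬝ᵥ v := by
  simp only [dualCone, PointedCone.mem_dual]
  refine forall₂_congr fun v _ => ?_
  rw [dotProduct_comm]
  rfl

/-- `Δ` is the Minkowski sum of the cone `σ` and of a (nonempty) polytope `conv Q` whose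
vertices lie in `F`. -/
def IsTailedPolyhedron (F : Set (ι → ℚ)) (σ : PointedCone ℚ (ι → ℚ)) (Δ : Set (ι → ℚ)) : Prop :=
  ∃ Q : Finset (ι → ℚ), Q.Nonempty ∧ (Q : Set (ι → ℚ)) ⊆ F ∧
    Δ = convexHull ℚ (Q : Set (ι → ℚ)) + (σ : Set (ι → ℚ))

open Classical in
/-- The support function `h_Δ(m) = min_{v ∈ Δ} m(v)` (by convention `0` where there is no
minimum; for a polyhedron `Δ` with tail cone `σ` the minimum exists for all `m ∈ σ^∨`). -/
def supportFn (Δ : Set (ι → ℚ)) (m : ι → ℚ) : ℚ :=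
  if h : ∃ a, IsLeast ((fun v => m ⬝ᵥ v) '' Δ) a then h.choose else 0

theorem supportFn_eq {Δ : Set (ι → ℚ)} {m : ι → ℚ} {a : ℚ}
    (h : IsLeast ((fun v => m ⬝ᵥ v) '' Δ) a) : supportFn Δ m = a := by
  have h' : ∃ a, IsLeast ((fun v => m ⬝ᵥ v) '' Δ) a := ⟨a, h⟩
  rw [supportFn, dif_pos h']
  exact h'.choose_spec.unique h

theorem IsTailedPolyhedron.isLeast_supportFn {F : Set (ι → ℚ)} {σ : PointedCone ℚ (ι → ℚ)}
    {Δ : Set (ι → ℚ)} (hΔ : IsTailedPolyhedron F σ Δ) {m : ι → ℚ}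
    (hm : m ∈ dualCone (σ : Set (ι → ℚ))) :
    IsLeast ((fun v => m ⬝ᵥ v) '' Δ) (supportFn Δ m) := by
  obtain ⟨Q, hQ, -, rfl⟩ := hΔ
  obtain ⟨q, hq, hmin⟩ := Q.exists_min_image (fun v => m ⬝ᵥ v) hQ
  have hl : IsLeast ((fun v => m ⬝ᵥ v) ''
      (convexHull ℚ (Q : Set (ι → ℚ)) + (σ : Set (ι → ℚ)))) (m ⬝ᵥ q) := by
    constructor
    · exact ⟨q, ⟨q, subset_convexHull ℚ _ hq, 0, σ.zero_mem, add_zero q⟩, rfl⟩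
    · rintro _ ⟨_, ⟨x, hx, y, hy, rfl⟩, rfl⟩
      have h1 : m ⬝ᵥ q ≤ m ⬝ᵥ x := by
        have hc : Convex ℚ {x : ι → ℚ | m ⬝ᵥ q ≤ m ⬝ᵥ x} :=
          convex_halfSpace_ge (𝕜 := ℚ) (f := fun x => m ⬝ᵥ x)
            ⟨fun a b => dotProduct_add m a b, fun c a => dotProduct_smul c m a⟩ _
        exact convexHull_min (fun v hv => hmin v hv) hc hx
      have h2 := mem_dualCone.mp hm y hy
      simp only [dotProduct_add]
      linarith
  rwa [supportFn_eq hl]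

/-- A lattice polyhedron `P` is normal if for all `e ≥ 1` the lattice points of `eP` are exactly
the sums of `e` lattice points of `P`. -/
def IsNormalPolyhedron (P : Set (ι → ℚ)) : Prop :=
  ∀ e : ℕ, 1 ≤ e → ∀ m : ι → ℤ, castQ m ∈ (e : ℚ) • P ↔
    ∃ f : Fin e → (ι → ℤ), (∀ j, castQ (f j) ∈ P) ∧ ∑ j, f j = m

/-- The vector `(v, p)` of `ℚ^ι × ℚ = ℚ^(ι ⊕ Unit)` (and similarly over `ℤ`). -/
def extend {R : Type*} (v : ι → R) (p : R) : ι ⊕ Unit → R := Sum.elim v fun _ => p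

/-- The cone `{(m, e) | e ≥ 0, m ∈ eP}` of `ℚ^ι × ℚ`, where `0P` means `σ^∨`. -/
def reesCone (σ : PointedCone ℚ (ι → ℚ)) (P : Set (ι → ℚ)) : Set (ι ⊕ Unit → ℚ) :=
  {x | ∃ (m : ι → ℚ) (e : ℚ), x = extend m e ∧
    (e = 0 ∧ m ∈ dualCone (σ : Set (ι → ℚ)) ∨ 0 < e ∧ m ∈ e • P)}

end Convex

/-! ### Polyhedral divisors on a smooth affine curve

The curve is `C = Spec R` with `R = k[C]` a Dedekind domain; `K = k(C)` is its fraction field, the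
points `z ∈ C` are the height one primes of `R`, and
`z.valuation K f = WithZero.exp (- ord_z f)`. -/

section Divisors

open IsDedekindDomain

variable {R : Type*} [CommRing R] [IsDedekindDomain R]
variable (K : Type*) [Field K] [Algebra R K] [IsFractionRing R K]
variable {ι : Type*} [Fintype ι]

/-- `H⁰(C, 𝒪_C(⌊D⌋))` for a rational divisor `D`: the `f ∈ k(C)` that are zero or satisfy
`ord_z f + ⌊D_z⌋ ≥ 0` for all `z`. -/
def globalSections (D : HeightOneSpectrum R → ℚ) : Submodule R K where
  carrier := {f | ∀ z : HeightOneSpectrum R, z.valuation K f ≤ WithZero.exp ⌊D z⌋}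
  zero_mem' z := by simp
  add_mem' {f g} hf hg z := (Valuation.map_add _ f g).trans (max_le (hf z) (hg z))
  smul_mem' c f hf z := by
    rw [Algebra.smul_def, map_mul]
    exact (mul_le_of_le_one_left' (z.valuation_le_one c)).trans (hf z)

variable (R) in
/-- A `σ`-polyhedral divisor `∑ Δ_z · z` on `C = Spec R`. -/
structure PolyhedralDivisor (σ : PointedCone ℚ (ι → ℚ)) where
  /-- The coefficient `Δ_z`. -/
  coeff : HeightOneSpectrum R → Set (ι → ℚ)
  isTailedPolyhedron : ∀ z, IsTailedPolyhedron Set.univ σ (coeff z)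
  finite_support : {z | coeff z ≠ (σ : Set (ι → ℚ))}.Finite

namespace PolyhedralDivisor

variable {σ : PointedCone ℚ (ι → ℚ)} (D : PolyhedralDivisor R σ)

/-- The support of a polyhedral divisor. -/
def support : Set (HeightOneSpectrum R) := {z | D.coeff z ≠ (σ : Set (ι → ℚ))}

/-- The evaluation `D(m) = ∑ h_{Δ_z}(m) · z`, for `m ∈ σ^∨`. -/
def eval (m : ι → ℤ) : HeightOneSpectrum R → ℚ := fun z => supportFn (D.coeff z) (castQ m)

theorem eval_zero (z : HeightOneSpectrum R) : D.eval 0 z = 0 := by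
  have h := (D.isTailedPolyhedron z).isLeast_supportFn
    (m := castQ (0 : ι → ℤ)) (mem_dualCone.mpr fun v _ => by simp [castQ, dotProduct])
  obtain ⟨v, -, hv⟩ := h.1
  simp only [eval, ← hv]
  simp [castQ, dotProduct]

theorem eval_add_le {m m' : ι → ℤ} (hm : castQ m ∈ dualCone (σ : Set (ι → ℚ)))
    (hm' : castQ m' ∈ dualCone (σ : Set (ι → ℚ))) (z : HeightOneSpectrum R) :
    D.eval m z + D.eval m' z ≤ D.eval (m + m') z := by
  have hc : castQ (m + m') = castQ m + castQ m' := by ext i; simp [castQ]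
  have h1 := (D.isTailedPolyhedron z).isLeast_supportFn hm
  have h2 := (D.isTailedPolyhedron z).isLeast_supportFn hm'
  have h3 := (D.isTailedPolyhedron z).isLeast_supportFn
    (hc ▸ add_mem hm hm' : castQ (m + m') ∈ dualCone (σ : Set (ι → ℚ)))
  obtain ⟨v, hv, hv'⟩ := h3.1
  have a1 := h1.2 ⟨v, hv, rfl⟩
  have a2 := h2.2 ⟨v, hv, rfl⟩
  simp only [eval, ← hv']
  rw [hc, add_dotProduct]
  exact add_le_add a1 a2

open Classical in
/-- The graded piece `A_m`: `H⁰(C, 𝒪_C(⌊D(m)⌋))` if `m ∈ σ^∨`, and `0` otherwise. -/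
def piece (m : ι → ℤ) : Submodule R K :=
  if castQ m ∈ dualCone (σ : Set (ι → ℚ)) then globalSections K (D.eval m) else ⊥

theorem mul_mem_piece {m m' : ι → ℤ} {f g : K} (hf : f ∈ D.piece K m)
    (hg : g ∈ D.piece K m') : f * g ∈ D.piece K (m + m') := by
  by_cases hm : castQ m ∈ dualCone (σ : Set (ι → ℚ))
  swap
  · rw [piece, if_neg hm, Submodule.mem_bot] at hf
    rw [hf, zero_mul]
    exact Submodule.zero_mem _
  by_cases hm' : castQ m' ∈ dualCone (σ : Set (ι → ℚ))
  swap
  · rw [piece, if_neg hm', Submodule.mem_bot] at hg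
    rw [hg, mul_zero]
    exact Submodule.zero_mem _
  have hc : castQ (m + m') = castQ m + castQ m' := by ext i; simp [castQ]
  rw [piece, if_pos hm] at hf
  rw [piece, if_pos hm'] at hg
  rw [piece, if_pos (hc ▸ add_mem hm hm')]
  intro z
  rw [map_mul]
  refine (mul_le_mul' (hf z) (hg z)).trans ?_
  rw [← WithZero.exp_add, WithZero.exp_le_exp]
  exact (Int.le_floor_add _ _).trans (Int.floor_le_floor (D.eval_add_le hm hm' z))

theorem algebraMap_mem_piece (r : R) : algebraMap R K r ∈ D.piece K 0 := by
  rw [piece, if_pos (mem_dualCone.mpr fun v _ => by simp [castQ, dotProduct])]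
  intro z
  rw [D.eval_zero z]
  simpa using z.valuation_le_one r

/-- The `M`-graded algebra
`A[C, D] = ⨁_{m ∈ σ^∨ ∩ M} H⁰(C, 𝒪_C(⌊D(m)⌋)) χ^m ⊆ k(C)[M]`, where `M = ℤ^ι`. -/
def algebra : Subalgebra R (AddMonoidAlgebra K (ι → ℤ)) where
  carrier := {F | ∀ m, F.coeff m ∈ D.piece K m}
  mul_mem' {F G} hF hG m := by
    classical
    rw [AddMonoidAlgebra.coeff_mul]
    refine Submodule.sum_mem _ fun a _ => Submodule.sum_mem _ fun b _ => ?_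
    dsimp only
    split_ifs with h
    · exact h ▸ D.mul_mem_piece K (hF a) (hG b)
    · exact Submodule.zero_mem _
  add_mem' {F G} hF hG m := by
    rw [AddMonoidAlgebra.coeff_add]
    exact Submodule.add_mem _ (hF m) (hG m)
  algebraMap_mem' r m := by
    classical
    rw [AddMonoidAlgebra.coe_algebraMap, Function.comp_apply, AddMonoidAlgebra.coeff_single,
      Finsupp.single_apply]
    split_ifs with h
    · exact h ▸ D.algebraMap_mem_piece K r
    · exact Submodule.zero_mem _

/-- An ideal of `A[C, D]` is homogeneous if it is nonzero and generated by homogeneous elements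
`f χ^m`. -/
def IsHomogeneousIdeal (I : Ideal (D.algebra K)) : Prop :=
  I ≠ ⊥ ∧ ∃ S : Set (D.algebra K),
    (∀ a ∈ S, ∃ (m : ι → ℤ) (f : K),
      (a : AddMonoidAlgebra K (ι → ℤ)) = AddMonoidAlgebra.single m f) ∧
    I = Ideal.span S

/-- `(P, D')` is the pair associated with the ideal `I` of `A[C, D]`. -/
structure IsAssociatedPair (I : Ideal (D.algebra K)) (P : Set (ι → ℚ))
    (D' : PolyhedralDivisor R (dualCone (reesCone σ P))) : Prop where
  /-- `P` is the sum of `σ^∨` and of a polytope with vertices in `σ^∨ ∩ M`. -/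
  polyhedron : IsTailedPolyhedron
    {x | x ∈ dualCone (σ : Set (ι → ℚ)) ∧ ∃ m : ι → ℤ, x = castQ m}
    (dualCone (σ : Set (ι → ℚ))) P
  /-- `Δ_z` is the projection of `Δ'_z`. -/
  projection : ∀ z, D.coeff z = (fun w i => w (Sum.inl i)) '' D'.coeff z
  /-- Every vertex `(v, p)` of `Δ'_z` satisfies `p ≤ 0`. -/
  vertex : ∀ z (v : ι → ℚ) (p : ℚ), extend v p ∈ Set.extremePoints ℚ (D'.coeff z) → p ≤ 0
  /-- `Δ'_z` is the intersection in `Δ_z × ℚ` of finitely many half-spaces `m(v) + p ≥ e`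
  with `m ∈ P ∩ M` and `e ∈ ℤ`. -/
  halfSpaces : ∀ z, ∃ H : Finset ((ι → ℤ) × ℤ), (∀ h ∈ H, castQ h.1 ∈ P) ∧
    ∀ (v : ι → ℚ) (p : ℚ), extend v p ∈ D'.coeff z ↔
      v ∈ D.coeff z ∧ ∀ h ∈ H, (h.2 : ℚ) ≤ castQ h.1 ⬝ᵥ v + p
  /-- `I = ⨁_{m ∈ P ∩ M} H⁰(C, 𝒪_C(⌊D'(m, 1)⌋)) χ^m`. -/
  ideal_eq : ((↑) : D.algebra K → AddMonoidAlgebra K (ι → ℤ)) '' (I : Set (D.algebra K)) =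
    {F | ∀ m, F.coeff m ≠ 0 →
      castQ m ∈ P ∧ F.coeff m ∈ globalSections K (D'.eval (extend m 1))}

/-- For a divisor `D'` with coefficients `Δ'_z`, the polyhedron
`P'_z = conv {(m, i) ∈ (P ∩ M) × ℤ | h_{Δ'_z}(m, 1) ≥ -i}`. -/
def localPolyhedron {τ : PointedCone ℚ (ι ⊕ Unit → ℚ)} (D' : PolyhedralDivisor R τ)
    (P : Set (ι → ℚ)) (z : HeightOneSpectrum R) : Set (ι ⊕ Unit → ℚ) :=
  convexHull ℚ {x | ∃ (m : ι → ℤ) (i : ℤ), x = castQ (extend m i) ∧ castQ m ∈ P ∧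
    -(i : ℚ) ≤ D'.eval (extend m 1) z}

end PolyhedralDivisor

end Divisors

/-! ### Actions of the multiplicative group on affine varieties -/

section Action

variable {k B : Type*} [Field k] [CommRing B] [Algebra k B]

/-- The action of `k^*` on `Spec B` given by `ρ` is algebraic: `t ↦ ρ t b` is a Laurent polynomial
in `t` with coefficients in `B`, for all `b`. -/
def IsAlgebraicAction (ρ : kˣ →* (B ≃ₐ[k] B)) : Prop :=
  ∀ b : B, ∃ c : ℤ →₀ B, ∀ t : kˣ, ρ t b = c.sum fun m x => ((t ^ m : kˣ) : k) • x

/-- The weight space `B_m`. -/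
def weightSpace (ρ : kˣ →* (B ≃ₐ[k] B)) (m : ℤ) : Submodule k B where
  carrier := {b | ∀ t : kˣ, ρ t b = ((t ^ m : kˣ) : k) • b}
  zero_mem' t := by simp
  add_mem' {a b} ha hb t := by rw [map_add, ha t, hb t, smul_add]
  smul_mem' c a ha t := by rw [map_smul, ha t, smul_comm]

/-- The action is elliptic if `B_0 = k`. -/
def IsElliptic (ρ : kˣ →* (B ≃ₐ[k] B)) : Prop := weightSpace ρ 0 = 1

end Action

end ComplexityOne

end

open ComplexityOne

/-!
The orders at a point `z` of the homogeneous components `f χ^m` of the elements of a homogeneous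
ideal `J` form a subset of `M × ℤ`, and these subsets, for all `z`, determine `J`. Powers of ideals
correspond to sums of such subsets. Comparing valuations in an integral equation, one sees that a
monomial is integral over `J` near `z` if and only if one of its powers lies in the same power of
`J` there. Hence integral closures of powers correspond to the saturation of the monoid in
`M × ℤ × ℤ` spanned by the orders.

The lattice points of the polyhedron of an associated pair at `z` are the orders at `z` of the
elements of `I`, so its normality says that this monoid is already saturated. In general the monoid
has rank at most `n + 2` and is generated in degrees zero and one. By Carathéodory's theorem a
multiple of any element of its saturation is a combination of at most `n + 2` generators, and from
an element of degree greater than `n` one can split off an element of the saturation of degree one.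

The coordinate ring of a nonelliptic surface is a graded algebra of Laurent polynomials over the
field of invariants, with the ring of invariants as Dedekind base. Here `n = 1`, so `e = 1` is
allowed.
-/

noncomputable section

namespace ComplexityOne

/-! ### Saturated submonoids -/

section Saturation

variable {V : Type*}

/-- The saturation of a submonoid `T`: the elements some positive multiple of which lies in `T`. -/
def saturation [AddCommMonoid V] (T : AddSubmonoid V) : AddSubmonoid V where
  carrier := {x | ∃ N : ℕ, 0 < N ∧ N • x ∈ T}
  zero_mem' := ⟨1, one_pos, by simp⟩
  add_mem' := by
    rintro x y ⟨N, hN, hx⟩ ⟨N', hN', hy⟩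
    refine ⟨N * N', Nat.mul_pos hN hN', ?_⟩
    rw [nsmul_add, mul_nsmul, mul_nsmul']
    exact add_mem (nsmul_mem hx _) (nsmul_mem hy _)

theorem le_saturation [AddCommMonoid V] (T : AddSubmonoid V) : T ≤ saturation T :=
  fun x hx => ⟨1, one_pos, by rwa [one_nsmul]⟩

theorem mem_saturation_of_nsmul_mem_saturation [AddCommMonoid V] {T : AddSubmonoid V} {N : ℕ}
    (hN : 0 < N) {x : V} (hx : N • x ∈ saturation T) : x ∈ saturation T := by
  obtain ⟨N', hN', hx⟩ := hx
  exact ⟨N * N', Nat.mul_pos hN hN', by rwa [mul_nsmul]⟩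

variable [AddCommGroup V]

theorem exists_nsmul_eq_sum_erase [DecidableEq V] {s : Finset V} {n : V → ℕ} {N : ℕ} (hN : 0 < N)
    {x : V} (hx : N • x = ∑ t ∈ s, n t • t) {g : V → ℤ} (hg : ∑ t ∈ s, g t • t = 0)
    (hpos : ∃ t ∈ s, 0 < g t) :
    ∃ t₀ ∈ s, ∃ N' : ℕ, 0 < N' ∧ ∃ n' : V → ℕ, N' • x = ∑ t ∈ s.erase t₀, n' t • t := by
  obtain ⟨t₀, ht₀, hmin⟩ := (s.filter (0 < g ·)).exists_min_image (fun t => (n t : ℚ) / g t)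
    (by simpa [Finset.Nonempty] using hpos)
  obtain ⟨ht₀s, hg₀⟩ := Finset.mem_filter.mp ht₀
  have coeff_nonneg : ∀ t ∈ s, 0 ≤ g t₀ * n t - n t₀ * g t := by
    intro t ht
    rcases lt_or_ge 0 (g t) with hgt | hgt
    · have hdiv := hmin t (Finset.mem_filter.mpr ⟨ht, hgt⟩)
      rw [div_le_div_iff₀ (by exact_mod_cast hg₀) (by exact_mod_cast hgt)] at hdiv
      have : (n t₀ : ℤ) * g t ≤ n t * g t₀ := by exact_mod_cast hdiv
      linarith
    · exact sub_nonneg.mpr ((mul_nonpos_of_nonneg_of_nonpos (by positivity) hgt).trans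
        (by positivity))
  refine ⟨t₀, ht₀s, (g t₀).toNat * N, Nat.mul_pos (Int.pos_iff_toNat_pos.mp hg₀) hN,
    fun t => (g t₀ * n t - n t₀ * g t).toNat, ?_⟩
  calc ((g t₀).toNat * N) • x = g t₀ • (N • x) := by
        rw [mul_comm, mul_nsmul, ← natCast_zsmul _ (g t₀).toNat, Int.toNat_of_nonneg hg₀.le]
    _ = ∑ t ∈ s, (g t₀ * n t - n t₀ * g t) • t := by
        rw [hx, Finset.smul_sum, ← sub_zero (∑ t ∈ s, _), ← smul_zero (n t₀ : ℤ), ← hg,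
          Finset.smul_sum, ← Finset.sum_sub_distrib]
        exact Finset.sum_congr rfl fun t _ => by module
    _ = ∑ t ∈ s.erase t₀, (g t₀ * n t - n t₀ * g t) • t := by
        rw [Finset.sum_erase]
        rw [mul_comm, sub_self, zero_zsmul]
    _ = _ := Finset.sum_congr rfl fun t ht => by
        rw [← natCast_zsmul, Int.toNat_of_nonneg (coeff_nonneg t (Finset.mem_of_mem_erase ht))]

theorem exists_linearIndepOn_nsmul_eq_sum {s : Finset V} {n : V → ℕ} {N : ℕ} (hN : 0 < N)
    {x : V} (hx : N • x = ∑ t ∈ s, n t • t) :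
    ∃ s' ⊆ s, LinearIndepOn ℤ id (s' : Set V) ∧
      ∃ N' : ℕ, 0 < N' ∧ ∃ n' : V → ℕ, N' • x = ∑ t ∈ s', n' t • t := by
  classical
  induction s using Finset.strongInduction generalizing n N with
  | H s ih =>
    by_cases hs : LinearIndepOn ℤ id (s : Set V)
    · exact ⟨s, subset_rfl, hs, N, hN, n, hx⟩
    · obtain ⟨g, hg, hpos⟩ : ∃ g : V → ℤ, ∑ t ∈ s, g t • t = 0 ∧ ∃ t ∈ s, 0 < g t := by
        rw [linearIndepOn_finset_iff] at hs
        push Not at hs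
        obtain ⟨g, hg, t, ht, hgt⟩ := hs
        rcases hgt.lt_or_gt with hneg | hpos
        · exact ⟨-g, by simpa using hg, t, ht, by simpa using hneg⟩
        · exact ⟨g, hg, t, ht, hpos⟩
      obtain ⟨t₀, ht₀, N', hN', n', hx'⟩ := exists_nsmul_eq_sum_erase hN hx hg hpos
      obtain ⟨s', hs', h⟩ := ih _ (Finset.erase_ssubset ht₀) hN' hx'
      exact ⟨s', hs'.trans (Finset.erase_subset _ _), h⟩

theorem exists_linearIndepOn_of_mem_saturation_closure {G : Set V} {x : V}
    (hx : x ∈ saturation (AddSubmonoid.closure G)) :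
    ∃ s : Finset V, (s : Set V) ⊆ G ∧ LinearIndepOn ℤ id (s : Set V) ∧
      ∃ N : ℕ, 0 < N ∧ ∃ n : V → ℕ, N • x = ∑ t ∈ s, n t • t := by
  obtain ⟨N, hN, hx⟩ := hx
  obtain ⟨n, s, hsG, -, hx⟩ := AddSubmonoid.mem_closure_iff_exists_finset_subset.mp hx
  obtain ⟨s', hs', hind, h⟩ := exists_linearIndepOn_nsmul_eq_sum hN hx.symm
  exact ⟨s', (Finset.coe_subset.mpr hs').trans hsG, hind, h⟩

section DegreeOne

variable {κ : Type*} [Fintype κ] {T : AddSubmonoid V} {t : κ → V} {n : κ → ℕ} {N : ℕ} {x : V}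

theorem sub_mem_saturation_of_nsmul_eq_sum (hN : 0 < N) (ht : ∀ i, t i ∈ saturation T)
    (hx : N • x = ∑ i, n i • t i) {j : κ} (hj : N ≤ n j) : x - t j ∈ saturation T := by
  classical
  refine mem_saturation_of_nsmul_mem_saturation hN ?_
  have : N • (x - t j) = (n j - N) • t j + ∑ i ∈ Finset.univ.erase j, n i • t i := by
    rw [smul_sub, hx, ← Finset.add_sum_erase _ _ (Finset.mem_univ j), sub_nsmul _ hj]
    abel
  rw [this]
  exact add_mem (nsmul_mem (ht j) _) (sum_mem fun i _ => nsmul_mem (ht i) _)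

theorem sum_sub_mem_saturation (hN : 0 < N) (ht : ∀ i, t i ∈ saturation T)
    (hx : N • x = ∑ i, n i • t i) (hn : ∀ i, n i ≤ N) : ∑ i, t i - x ∈ saturation T := by
  refine mem_saturation_of_nsmul_mem_saturation hN ?_
  rw [smul_sub, hx, Finset.smul_sum, ← Finset.sum_sub_distrib]
  refine sum_mem fun i _ => ?_
  rw [sub_eq_add_neg, ← sub_nsmul _ (hn i)]
  exact nsmul_mem (ht i) _

theorem nsmul_eq_sum_update [DecidableEq κ] (hx : N • x = ∑ i, n i • t i) {j : κ}
    (hjN : n j ≤ N) (hj : ∀ i, n j ≤ n i) :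
    (N - n j) • x =
      ∑ i, Function.update (n · - n j) j (n j) i • Function.update t j (∑ i, t i - x) i := by
  rw [← Finset.add_sum_erase _ _ (Finset.mem_univ j)]
  have hrest : ∑ i ∈ Finset.univ.erase j, Function.update (n · - n j) j (n j) i •
      Function.update t j (∑ i, t i - x) i =
        ∑ i ∈ Finset.univ.erase j, (n i • t i - n j • t i) :=
    Finset.sum_congr rfl fun i hi => by
      rw [Function.update_of_ne (Finset.ne_of_mem_erase hi),
        Function.update_of_ne (Finset.ne_of_mem_erase hi), sub_nsmul _ (hj i), sub_eq_add_neg]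
  rw [hrest, Finset.sum_erase _ (sub_self _), Function.update_self, Function.update_self,
    sub_nsmul _ hjN, hx, Finset.sum_sub_distrib, ← Finset.smul_sum]
  module

theorem forall_eq_one_and_pos_of_mul_eq_sum {δ : κ → ℤ} {d e : ℤ} (hδ : ∀ i, δ i = 0 ∨ δ i = 1)
    (hκ : (Fintype.card κ : ℤ) ≤ d + 1) (hd : 1 ≤ d) (hde : d ≤ e) (hN : 0 < N)
    (hsum : N * e = ∑ i, n i * δ i) (hn : ∀ i, δ i = 1 → n i < N) (j : κ) :
    δ j = 1 ∧ 0 < n j := by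
  classical
  have hle : ∀ i, n i * δ i ≤ (N : ℤ) - 1 := fun i => by
    rcases hδ i with h | h
    · rw [h]; omega
    · have := hn i h
      rw [h]; omega
  by_contra hj
  have hzero : n j * δ j = 0 := by
    rcases hδ j with h | h
    · rw [h, mul_zero]
    · rw [Nat.eq_zero_of_not_pos fun h' => hj ⟨h, h'⟩, Nat.cast_zero, zero_mul]
  have hcard : ((Finset.univ.erase j).card : ℤ) ≤ d := by
    rw [Finset.card_erase_of_mem (Finset.mem_univ j), Finset.card_univ]
    have := Fintype.card_pos_iff.mpr ⟨j⟩
    omega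
  have : N * e ≤ d * (N - 1) := by
    rw [hsum, ← Finset.sum_erase (f := fun i => n i * δ i) _ hzero]
    calc ∑ i ∈ Finset.univ.erase j, n i * δ i ≤ (Finset.univ.erase j).card • ((N : ℤ) - 1) :=
          Finset.sum_le_card_nsmul _ _ _ fun i _ => hle i
      _ ≤ d * (N - 1) := by
          rw [nsmul_eq_mul]
          exact mul_le_mul_of_nonneg_right hcard (by omega)
  nlinarith [mul_le_mul_of_nonneg_left hde (Int.natCast_nonneg N)]

theorem card_eq_add_one_and_eq_of_mul_eq_sum {d e : ℤ} (hκ : (Fintype.card κ : ℤ) ≤ d + 1)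
    (hd : 1 ≤ d) (hde : d ≤ e) (hN : 0 < N) (hsum : N * e = ∑ i, (n i : ℤ)) (hn : ∀ i, n i < N) :
    (Fintype.card κ : ℤ) = d + 1 ∧ e = d := by
  have hle : N * e ≤ Fintype.card κ * ((N : ℤ) - 1) := by
    rw [hsum, ← nsmul_eq_mul, ← Finset.card_univ]
    refine Finset.sum_le_card_nsmul _ _ _ fun i _ => ?_
    have := hn i
    omega
  have hcard : (Fintype.card κ : ℤ) = d + 1 := by
    by_contra hne
    have : (Fintype.card κ : ℤ) ≤ d := by omega
    nlinarith [mul_le_mul_of_nonneg_left hde (Int.natCast_nonneg N)]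
  refine ⟨hcard, le_antisymm ?_ hde⟩
  by_contra! hlt
  rw [hcard] at hle
  nlinarith

/-- If no `t j` of degree one can be split off directly, then all the `t i` have degree one and
`w = ∑ t i - x` has degree one too. Replacing by `w` the `t j` with the smallest coefficient
`n j` decreases the multiple `N`. -/
theorem exists_map_eq_one_of_nsmul_eq_sum (deg : V →+ ℤ) {d : ℤ}
    (hκ : (Fintype.card κ : ℤ) ≤ d + 1) (hd : 1 ≤ d) (hdx : d ≤ deg x) (hN : 0 < N)
    (ht : ∀ i, t i ∈ saturation T) (hdeg : ∀ i, deg (t i) = 0 ∨ deg (t i) = 1)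
    (hx : N • x = ∑ i, n i • t i) :
    ∃ v ∈ saturation T, deg v = 1 ∧ x - v ∈ saturation T := by
  classical
  induction N using Nat.strong_induction_on generalizing t n with
  | h N ih =>
    by_cases hlarge : ∃ j, deg (t j) = 1 ∧ N ≤ n j
    · obtain ⟨j, hj, hNj⟩ := hlarge
      exact ⟨t j, ht j, hj, sub_mem_saturation_of_nsmul_eq_sum hN ht hx hNj⟩
    push Not at hlarge
    have hsum : N * deg x = ∑ i, n i * deg (t i) := by
      simpa only [map_nsmul, map_sum, nsmul_eq_mul] using congrArg deg hx
    have hone := forall_eq_one_and_pos_of_mul_eq_sum hdeg hκ hd hdx hN hsum hlarge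
    have hlt : ∀ i, n i < N := fun i => hlarge i (hone i).1
    obtain ⟨hcard, hdegx⟩ := card_eq_add_one_and_eq_of_mul_eq_sum hκ hd hdx hN
      (by simpa only [(hone _).1, mul_one] using hsum) hlt
    have : Nonempty κ := Fintype.card_pos_iff.mp (by omega)
    obtain ⟨j, hj⟩ := Finite.exists_min n
    have hw : deg (∑ i, t i - x) = 1 := by
      simp only [map_sub, map_sum, (hone _).1, Finset.sum_const, Finset.card_univ, nsmul_one,
        hcard, hdegx, add_sub_cancel_left]
    have hjpos : 0 < n j := (hone j).2
    refine ih (N - n j) (by omega) (Nat.sub_pos_of_lt (hlt j)) (fun i => ?_) (fun i => ?_)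
      (nsmul_eq_sum_update hx (hlt j).le hj)
    · rcases eq_or_ne i j with rfl | hij
      · simpa using sum_sub_mem_saturation hN ht hx fun i => (hlt i).le
      · simpa [hij] using ht i
    · rcases eq_or_ne i j with rfl | hij
      · simp [hw]
      · simpa [hij] using hdeg i

theorem exists_sub_mem_saturation_closure [Module.Finite ℤ V] {G : Set V} (deg : V →+ ℤ)
    (hG : ∀ g ∈ G, deg g = 0 ∨ deg g = 1) {d : ℕ} (hV : Module.finrank ℤ V ≤ d + 1)
    (hd : 1 ≤ d) {x : V} (hx : x ∈ saturation (AddSubmonoid.closure G)) (hdx : d ≤ deg x) :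
    ∃ v ∈ saturation (AddSubmonoid.closure G), deg v = 1 ∧
      x - v ∈ saturation (AddSubmonoid.closure G) := by
  obtain ⟨s, hsG, hind, N, hN, n, hx⟩ := exists_linearIndepOn_of_mem_saturation_closure hx
  have hcard : s.card ≤ d + 1 := (LinearIndependent.finset_card_le_finrank hind).trans hV
  refine exists_map_eq_one_of_nsmul_eq_sum (κ := s) (t := (↑)) (n := fun t => n t) (d := d) deg
    (by simpa using mod_cast hcard) (by exact_mod_cast hd) hdx hN
    (fun i => le_saturation _ (AddSubmonoid.subset_closure (hsG i.2))) (fun i => hG i (hsG i.2)) ?_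
  rw [hx, Finset.sum_coe_sort s fun t => n t • t]

end DegreeOne

end Saturation

/-! ### Homogeneous ideals -/

section IntegralOverIdeal

variable {A A' : Type*} [CommRing A] [CommRing A']

theorem IsIntegralOverIdeal.map {I : Ideal A} {a : A} (h : IsIntegralOverIdeal I a)
    (f : A →+* A') : IsIntegralOverIdeal (I.map f) (f a) := by
  obtain ⟨r, hr, l, hl, h⟩ := h
  refine ⟨r, hr, fun i => f (l i), fun i hi => ?_, ?_⟩
  · rw [← Ideal.map_pow]
    exact Ideal.mem_map_of_mem f (hl i hi)
  · simp only [← map_pow, ← map_mul, ← map_sum, ← map_add, h, map_zero]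

theorem IsIntegralOverIdeal.mono {I J : Ideal A} (hIJ : I ≤ J) {a : A}
    (h : IsIntegralOverIdeal I a) : IsIntegralOverIdeal J a := by
  obtain ⟨r, hr, l, hl, h⟩ := h
  exact ⟨r, hr, l, fun i hi => Ideal.pow_right_mono hIJ i (hl i hi), h⟩

theorem le_idealClosure (I : Ideal A) : I ≤ idealClosure I :=
  fun a ha => ⟨1, le_rfl, fun _ => -a, by simpa using ha, by simp⟩

theorem IsIntegrallyClosedIdeal.idealClosure_eq {I : Ideal A} (h : IsIntegrallyClosedIdeal I) :
    idealClosure I = I :=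
  le_antisymm h (le_idealClosure I)

theorem IsIntegrallyClosedIdeal.map_equiv {I : Ideal A} (h : IsIntegrallyClosedIdeal I)
    (e : A ≃+* A') : IsIntegrallyClosedIdeal (I.map (e : A →+* A')) := by
  intro a ha
  have h1 := ha.map (e.symm : A' →+* A)
  rw [Ideal.map_map, RingEquiv.symm_comp, Ideal.map_id] at h1
  simpa using Ideal.mem_map_of_mem (e : A →+* A') (h _ h1)

theorem IsNormalIdeal.map_equiv {I : Ideal A} (h : IsNormalIdeal I) (e : A ≃+* A') :
    IsNormalIdeal (I.map (e : A →+* A')) := fun r hr => by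
  rw [← Ideal.map_pow]
  exact (h r hr).map_equiv e

theorem isIntegral_of_pow_add_sum_eq_zero [Algebra A A'] {r : ℕ} (hr : 1 ≤ r) {x : A'}
    (l : ℕ → A)
    (h : x ^ r + ∑ i ∈ Finset.Icc 1 r, algebraMap A A' (l i) * x ^ (r - i) = 0) :
    IsIntegral A x := by
  refine ⟨Polynomial.X ^ r + ∑ i ∈ Finset.Icc 1 r, Polynomial.monomial (r - i) (l i),
    Polynomial.monic_X_pow_add ?_, ?_⟩
  · refine (Polynomial.degree_sum_le _ _).trans_lt ?_
    rw [Finset.sup_lt_iff (by exact_mod_cast WithBot.bot_lt_coe r)]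
    intro i hi
    refine (Polynomial.degree_monomial_le _ _).trans_lt ?_
    have := Finset.mem_Icc.mp hi
    exact_mod_cast (by lia : r - i < r)
  · simpa only [Polynomial.eval₂_add, Polynomial.eval₂_X_pow, Polynomial.eval₂_finsetSum,
      Polynomial.eval₂_monomial] using h

open Polynomial in
/-- Multiplied by a second variable `Y`, an integral equation of `p` over `I` becomes an integral
equation of `Y p` over `(reesAlgebra I)[X]`, and integrality over a polynomial ring is
coefficientwise. -/
theorem IsIntegralOverIdeal.coeff {I : Ideal A} {p : A[X]} (h : IsIntegralOverIdeal (I.map C) p)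
    (n : ℕ) : IsIntegralOverIdeal I (p.coeff n) := by
  let := Polynomial.algebra (reesAlgebra I) A[X]
  obtain ⟨r, hr, l, hl, h⟩ := h
  have hlift (i : ℕ) (hi : i ∈ Finset.Icc 1 r) : ∃ c : (reesAlgebra I)[X],
      algebraMap (reesAlgebra I)[X] A[X][X] c = Bivariate.swap (monomial i (l i)) := by
    refine (mem_lifts (f := algebraMap (reesAlgebra I) A[X]) _).mp ?_
    refine (lifts_iff_coeff_lifts _).mpr fun j =>
      ⟨⟨monomial i ((l i).coeff j), reesAlgebra.monomial_mem.mpr ?_⟩, ?_⟩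
    · have := hl i hi
      rw [← Ideal.map_pow] at this
      exact Ideal.mem_map_C_iff.mp this j
    · rw [Bivariate.swap_monomial, coeff_mul_C, coeff_map, C_mul_X_pow_eq_monomial]
      rfl
  choose! c hc using hlift
  have hint : IsIntegral (reesAlgebra I)[X] (Bivariate.swap (monomial 1 p)) := by
    refine isIntegral_of_pow_add_sum_eq_zero hr c ?_
    have hterm (i : ℕ) (hi : i ∈ Finset.Icc 1 r) :
        algebraMap (reesAlgebra I)[X] A[X][X] (c i) * Bivariate.swap (monomial 1 p) ^ (r - i) =
          Bivariate.swap (monomial r (l i * p ^ (r - i))) := by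
      rw [hc i hi, ← map_pow, ← map_mul, monomial_pow, monomial_mul_monomial, one_mul,
        Nat.add_sub_cancel' (Finset.mem_Icc.mp hi).2]
    rw [Finset.sum_congr rfl hterm, ← map_pow, monomial_pow, one_mul, ← map_sum, ← map_add,
      ← map_sum, ← map_add, h, map_zero, map_zero]
  rw [isIntegralOverIdeal_iff]
  have hcoeff := isIntegral_iff_isIntegral_coeff.mp hint n
  rwa [Bivariate.swap_monomial, coeff_mul_C, coeff_map, C_mul_X_pow_eq_monomial] at hcoeff

theorem IsIntegralOverIdeal.exists_mul_eq_algebraMap [Algebra A A'] (M : Submonoid A)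
    [IsLocalization M A'] (hM : M ≤ nonZeroDivisors A) {J : Ideal A} {x : A'}
    (hx : IsIntegralOverIdeal (J.map (algebraMap A A')) x) :
    ∃ m ∈ M, ∃ a, IsIntegralOverIdeal J a ∧ algebraMap A A' a = algebraMap A A' m * x := by
  obtain ⟨r, hr, l, hl, h⟩ := hx
  have hden (i : ℕ) (hi : i ∈ Finset.Icc 1 r) :
      ∃ j ∈ J ^ i, ∃ s ∈ M, algebraMap A A' s * l i = algebraMap A A' j := by
    have := hl i hi
    rw [← Ideal.map_pow] at this
    obtain ⟨⟨⟨j, hj⟩, s⟩, hs⟩ := (IsLocalization.mem_map_algebraMap_iff M A').mp this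
    exact ⟨j, hj, s, s.2, by rw [mul_comm, hs]⟩
  choose! j hj s hs hsj using hden
  obtain ⟨⟨a, s'⟩, ha⟩ := IsLocalization.surj M x
  let m : A := s' * ∏ i ∈ Finset.Icc 1 r, s i
  have hdvd (i : ℕ) (hi : i ∈ Finset.Icc 1 r) : s i ∣ m ^ i :=
    ((Finset.dvd_prod_of_mem s hi).mul_left _).trans
      (dvd_pow_self m (Nat.one_le_iff_ne_zero.mp (Finset.mem_Icc.mp hi).1))
  choose! q hq using hdvd
  have hm : algebraMap A A' (a * ∏ i ∈ Finset.Icc 1 r, s i) = algebraMap A A' m * x := by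
    rw [map_mul, map_mul, ← ha]
    ring
  refine ⟨m, mul_mem s'.2 (prod_mem hs), _, ⟨r, hr, fun i => j i * q i, fun i hi =>
    Ideal.mul_mem_right _ _ (hj i hi), IsLocalization.injective A' hM ?_⟩, hm⟩
  have hterm (i : ℕ) (hi : i ∈ Finset.Icc 1 r) :
      algebraMap A A' (j i * q i) * (algebraMap A A' m * x) ^ (r - i) =
        algebraMap A A' m ^ r * (l i * x ^ (r - i)) := by
    rw [map_mul, ← hsj i hi, mul_right_comm (algebraMap A A' (s i)), ← map_mul, ← hq i hi,
      map_pow, mul_pow]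
    nth_rewrite 3 [← Nat.add_sub_cancel' (Finset.mem_Icc.mp hi).2]
    rw [pow_add]
    ring
  simp only [map_add, map_sum, map_mul _ (j _ * q _), map_pow, hm, map_zero]
  rw [Finset.sum_congr rfl hterm, mul_pow, ← Finset.mul_sum, ← mul_add, h, mul_zero]

open LaurentPolynomial in
theorem coeff_toLaurent_natCast (q : Polynomial A) (n : ℕ) :
    (Polynomial.toLaurent q).coeff (n : ℤ) = q.coeff n :=
  Finsupp.mapDomain_apply Nat.cast_injective q.toFinsupp.coeff n

theorem coeff_toLaurent_of_neg (q : Polynomial A) {n : ℤ} (hn : n < 0) :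
    (Polynomial.toLaurent q).coeff n = 0 :=
  Finsupp.mapDomain_of_notMem_range q.toFinsupp.coeff n fun ⟨m, hm⟩ => by
    have : (m : ℤ) = n := hm
    lia

open LaurentPolynomial in
theorem IsIntegralOverIdeal.laurentPolynomial_coeff {I : Ideal A} {p : LaurentPolynomial A}
    (h : IsIntegralOverIdeal (I.map C) p) (n : ℤ) : IsIntegralOverIdeal I (p.coeff n) := by
  have hmap : I.map (C : A →+* LaurentPolynomial A) =
      (I.map Polynomial.C).map (algebraMap (Polynomial A) (LaurentPolynomial A)) := by
    rw [Ideal.map_map]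
    congr 1
    ext1 a
    exact (Polynomial.toLaurent_C a).symm
  have hX : Submonoid.powers (Polynomial.X : Polynomial A) ≤ nonZeroDivisors (Polynomial A) :=
    Submonoid.powers_le.mpr Polynomial.X_mem_nonzeroDivisors
  rw [hmap] at h
  obtain ⟨_, ⟨d, rfl⟩, q, hq, hqp⟩ := h.exists_mul_eq_algebraMap _ hX
  have hcoeff : p.coeff n = (Polynomial.toLaurent q).coeff (d + n) := by
    rw [← algebraMap_eq_toLaurent, hqp, algebraMap_X_pow, T,
      AddMonoidAlgebra.coeff_single_mul_eq_mul_coeff n (by simp), one_mul]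
  rw [hcoeff]
  obtain hneg | hnonneg := lt_or_ge (d + n) 0
  · rw [coeff_toLaurent_of_neg q hneg]
    exact (idealClosure I).zero_mem
  · obtain ⟨j, hj⟩ := Int.eq_ofNat_of_zero_le hnonneg
    rw [hj, coeff_toLaurent_natCast]
    exact hq.coeff j

end IntegralOverIdeal

theorem exists_addMonoidHom_forall_ne_zero {M : Type*} [AddCommGroup M] [Module.Free ℤ M]
    [Module.Finite ℤ M] (s : Finset M) (hs : 0 ∉ s) : ∃ φ : M →+ ℤ, ∀ m ∈ s, φ m ≠ 0 := by
  let b := Module.finBasis ℤ M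
  let ψ : M →ₗ[ℤ] Polynomial ℤ := Submodule.subtype _ ∘ₗ
    (b.equivFun.trans (Polynomial.degreeLTEquiv ℤ _).symm).toLinearMap
  have hψ : Function.Injective ψ := Subtype.val_injective.comp (LinearEquiv.injective _)
  have hprod : ∏ m ∈ s, ψ m ≠ 0 := Finset.prod_ne_zero_iff.mpr fun m hm =>
    (map_ne_zero_iff ψ hψ).mpr (ne_of_mem_of_not_mem hm hs)
  obtain ⟨t, ht⟩ : ∃ t : ℤ, (∏ m ∈ s, ψ m).eval t ≠ 0 := by
    by_contra! h
    exact hprod (Polynomial.funext fun t => by simpa using h t)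
  rw [Polynomial.eval_prod, Finset.prod_ne_zero_iff] at ht
  exact ⟨((Polynomial.leval t).comp ψ).toAddMonoidHom, ht⟩

section Homogeneous

open DirectSum LaurentPolynomial

variable {M A σ : Type*} [AddCommGroup M] [DecidableEq M] [CommRing A] [SetLike σ A]
  [AddSubmonoidClass σ A] (𝒜 : M → σ) [GradedRing 𝒜]

/-- The coaction `F ↦ ∑ F_m T ^ φ(m)` of the one-parameter subgroup `φ` on an `M`-graded ring. -/
def coaction (φ : M →+ ℤ) : A →+* LaurentPolynomial A :=
  (DirectSum.toSemiring
    (fun m => ((AddMonoidAlgebra.singleAddHom (φ m)).comp (AddSubmonoidClass.subtype (𝒜 m))))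
    (congrArg (AddMonoidAlgebra.single · 1) φ.map_zero)
    (fun _ _ => (congrArg (AddMonoidAlgebra.single · _) (φ.map_add _ _)).trans
      (AddMonoidAlgebra.single_mul_single _ _ _ _).symm)).comp
    (decomposeRingEquiv 𝒜 : A →+* ⨁ m, 𝒜 m)

theorem coaction_coe (φ : M →+ ℤ) {m : M} (a : 𝒜 m) :
    coaction 𝒜 φ a = .single (φ m) (a : A) := by
  have h : (decomposeRingEquiv 𝒜 : A →+* ⨁ m, 𝒜 m) a = of (fun m => 𝒜 m) m a :=
    decompose_coe 𝒜 a
  rw [coaction, RingHom.comp_apply, h]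
  exact toSemiring_of (A := fun m => 𝒜 m) _ _ _ m a

open scoped Classical in
theorem coaction_eq_sum (φ : M →+ ℤ) (F : A) :
    coaction 𝒜 φ F = ∑ m ∈ (decompose 𝒜 F).support, .single (φ m) (decompose 𝒜 F m : A) := by
  conv_lhs => rw [← sum_support_decompose 𝒜 F, map_sum]
  exact Finset.sum_congr rfl fun m _ => coaction_coe 𝒜 φ _

theorem map_coaction_le (φ : M →+ ℤ) {I : Ideal A} (hI : I.IsHomogeneous 𝒜) :
    I.map (coaction 𝒜 φ) ≤ I.map C := by
  refine Ideal.map_le_iff_le_comap.mpr fun F hF => ?_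
  rw [Ideal.mem_comap, coaction_eq_sum]
  refine sum_mem fun m _ => ?_
  rw [single_eq_C_mul_T]
  exact Ideal.mul_mem_right _ _ (Ideal.mem_map_of_mem C (hI m hF))

theorem coeff_coaction {φ : M →+ ℤ} {F : A} {m : M}
    (hm : ∀ m', decompose 𝒜 F m' ≠ 0 → φ m' = φ m → m' = m) :
    (coaction 𝒜 φ F).coeff (φ m) = decompose 𝒜 F m := by
  classical
  simp only [coaction_eq_sum, AddMonoidAlgebra.coeff_sum, Finsupp.finsetSum_apply,
    AddMonoidAlgebra.coeff_single]
  rw [Finset.sum_eq_single m, Finsupp.single_eq_same]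
  · exact fun m' hm' hne => Finsupp.single_eq_of_ne fun h =>
      hne (hm m' (DFinsupp.mem_support_iff.mp hm') h.symm)
  · simp

theorem isHomogeneous_pow {I : Ideal A} (hI : I.IsHomogeneous 𝒜) (e : ℕ) :
    (I ^ e).IsHomogeneous 𝒜 := by
  induction e with
  | zero => simpa using Ideal.IsHomogeneous.top 𝒜
  | succ e ih => exact pow_succ I e ▸ ih.mul hI

variable [Module.Free ℤ M] [Module.Finite ℤ M]

/-- The exponents of `F` are separated by some coaction, so its components are coefficients of a
Laurent polynomial integral over `I[T, T⁻¹]`. -/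
theorem isHomogeneous_idealClosure {I : Ideal A} (hI : I.IsHomogeneous 𝒜) :
    (idealClosure I).IsHomogeneous 𝒜 := by
  classical
  intro m F hF
  obtain ⟨φ, hφ⟩ := exists_addMonoidHom_forall_ne_zero
    (((decompose 𝒜 F).support.image (· - m)).erase 0) (by simp)
  have h := (IsIntegralOverIdeal.map hF (coaction 𝒜 φ)).mono (map_coaction_le 𝒜 φ hI)
  rw [← coeff_coaction 𝒜 (φ := φ) fun m' hm' hφm => ?_]
  · exact h.laurentPolynomial_coeff (φ m)
  · by_contra hne
    exact hφ (m' - m) (Finset.mem_erase.mpr ⟨sub_ne_zero.mpr hne,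
      Finset.mem_image_of_mem _ (DFinsupp.mem_support_iff.mpr hm')⟩)
      (by rw [map_sub, hφm, sub_self])

end Homogeneous

section GradedPiece

open DirectSum

variable {R K M : Type*} [CommRing R] [Field K] [Algebra R K] [AddCommGroup M]
  (A : Subalgebra R (AddMonoidAlgebra K M))

/-- The elements `f χ^m` of degree `m` of a subalgebra `A` of `K[M]`. -/
def gradedPiece (m : M) : Submodule R A :=
  ((AddMonoidAlgebra.grade K m).restrictScalars R).comap A.val.toLinearMap

variable {A}

theorem mem_gradedPiece {m : M} {F : A} :
    F ∈ gradedPiece A m ↔ ∃ f : K, (F : AddMonoidAlgebra K M) = .single m f := by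
  exact (AddMonoidAlgebra.mem_grade_iff' K m (F : AddMonoidAlgebra K M)).trans
    (exists_congr fun f => eq_comm)

theorem coe_eq_single_coeff {m : M} {F : A} (hF : F ∈ gradedPiece A m) :
    (F : AddMonoidAlgebra K M) = .single m ((F : AddMonoidAlgebra K M).coeff m) := by
  obtain ⟨f, hf⟩ := mem_gradedPiece.mp hF
  rw [hf, AddMonoidAlgebra.coeff_single, Finsupp.single_eq_same]

instance gradedMonoid_gradedPiece : SetLike.GradedMonoid (gradedPiece A) where
  one_mem := mem_gradedPiece.mpr ⟨1, rfl⟩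
  mul_mem _ _ F G hF hG := by
    obtain ⟨f, hf⟩ := mem_gradedPiece.mp hF
    obtain ⟨g, hg⟩ := mem_gradedPiece.mp hG
    exact mem_gradedPiece.mpr ⟨f * g, by
      rw [Subalgebra.coe_mul, hf, hg, AddMonoidAlgebra.single_mul_single]⟩

variable [DecidableEq M]

theorem coeff_coeAddMonoidHom (x : ⨁ m, gradedPiece A m) (m : M) :
    (DirectSum.coeAddMonoidHom (gradedPiece A) x : AddMonoidAlgebra K M).coeff m =
      ((x m : A) : AddMonoidAlgebra K M).coeff m := by
  induction x using DirectSum.induction_on with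
  | zero => simp
  | of m' F =>
    rw [DirectSum.coeAddMonoidHom_of]
    by_cases h : m' = m
    · subst h
      rw [of_eq_same]
    · rw [of_eq_of_ne _ _ _ (Ne.symm h), coe_eq_single_coeff F.2, AddMonoidAlgebra.coeff_single,
        Finsupp.single_eq_of_ne (Ne.symm h)]
      rfl
  | add x y hx hy =>
    rw [map_add, DirectSum.add_apply]
    push_cast
    rw [AddMonoidAlgebra.coeff_add, AddMonoidAlgebra.coeff_add, Finsupp.add_apply,
      Finsupp.add_apply, hx, hy]

variable (hA : ∀ F ∈ A, ∀ m, AddMonoidAlgebra.single m (F.coeff m) ∈ A)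

/-- The decomposition of `F` into its components `F.coeff m χ^m`, if they belong to `A`. -/
def singleCoeff (F : A) : ⨁ m, gradedPiece A m :=
  DirectSum.mk _ (F : AddMonoidAlgebra K M).coeff.support fun m =>
    ⟨⟨_, hA F F.2 m⟩, mem_gradedPiece.mpr ⟨_, rfl⟩⟩

theorem coe_singleCoeff (F : A) (m : M) :
    ((singleCoeff hA F m : A) : AddMonoidAlgebra K M) =
      .single m ((F : AddMonoidAlgebra K M).coeff m) := by
  by_cases hm : m ∈ (F : AddMonoidAlgebra K M).coeff.support
  · rw [singleCoeff, mk_apply_of_mem hm]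
  · rw [singleCoeff, mk_apply_of_notMem hm, Finsupp.notMem_support_iff.mp hm,
      AddMonoidAlgebra.single_zero]
    rfl

/-- The grading of a subalgebra of `K[M]` that contains the homogeneous components of its
elements. -/
abbrev gradedRingOfSingleCoeffMem : GradedRing (gradedPiece A) where
  decompose' := singleCoeff hA
  left_inv F := by
    ext m
    rw [coeff_coeAddMonoidHom, coe_singleCoeff, AddMonoidAlgebra.coeff_single,
      Finsupp.single_eq_same]
  right_inv x := by
    ext m : 3
    rw [coe_singleCoeff, coeff_coeAddMonoidHom, ← coe_eq_single_coeff (x m).2]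

variable [GradedRing (gradedPiece A)]

theorem coe_decompose (F : A) (m : M) :
    ((decompose (gradedPiece A) F m : A) : AddMonoidAlgebra K M) =
      .single m ((F : AddMonoidAlgebra K M).coeff m) := by
  have h : DirectSum.coeAddMonoidHom (gradedPiece A) (decompose (gradedPiece A) F) = F :=
    (decompose (gradedPiece A)).symm_apply_apply F
  rw [coe_eq_single_coeff (decompose (gradedPiece A) F m).2, ← coeff_coeAddMonoidHom, h]

end GradedPiece

/-! ### Orders of homogeneous components -/

section Valuation

variable {K Γ₀ : Type*} [Field K] [LinearOrderedCommGroupWithZero Γ₀] (v : Valuation K Γ₀)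

theorem exists_le_valuation_coeff_mul_coeff {M : Type*} [AddMonoid M] {F G : AddMonoidAlgebra K M}
    {m : M} {γ : Γ₀} (hγ : γ ≠ 0) (h : γ ≤ v ((F * G).coeff m)) :
    ∃ m₁ m₂, m₁ + m₂ = m ∧ γ ≤ v (F.coeff m₁ * G.coeff m₂) := by
  classical
  contrapose! h
  rw [AddMonoidAlgebra.coeff_mul]
  refine v.map_sum_lt hγ fun m₁ _ => v.map_sum_lt hγ fun m₂ _ => ?_
  dsimp only
  split_ifs with hm
  · exact h m₁ m₂ hm
  · rw [map_zero]
    exact zero_lt_iff.mpr hγ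

theorem exists_valuation_pow_le_of_pow_add_sum_eq_zero {r : ℕ} {f : K} (hf : f ≠ 0) {c : ℕ → K}
    (h : f ^ r + ∑ i ∈ Finset.Icc 1 r, c i * f ^ (r - i) = 0) :
    ∃ i ∈ Finset.Icc 1 r, v f ^ i ≤ v (c i) := by
  by_contra! hlt
  have hpos : 0 < v f := zero_lt_iff.mpr ((Valuation.ne_zero_iff _).mpr hf)
  refine lt_irrefl (v (f ^ r)) ?_
  conv_lhs => rw [eq_neg_of_add_eq_zero_left h, Valuation.map_neg]
  refine v.map_sum_lt ((Valuation.ne_zero_iff _).mpr (pow_ne_zero _ hf)) fun i hi => ?_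
  rw [map_mul, map_pow, map_pow, ← pow_mul_pow_sub (v f) (Finset.mem_Icc.mp hi).2]
  exact mul_lt_mul_of_pos_right (hlt i hi) (pow_pos hpos _)

end Valuation

section Orders

open DirectSum IsDedekindDomain

variable {R K M : Type*} [CommRing R] [IsDedekindDomain R] [Field K] [Algebra R K]
  [IsFractionRing R K] [AddCommGroup M] {A : Subalgebra R (AddMonoidAlgebra K M)}

theorem exists_valuation_eq_exp (z : HeightOneSpectrum R) {f : K} (hf : f ≠ 0) :
    ∃ c : ℤ, z.valuation K f = WithZero.exp (-c) :=
  ⟨-(z.valuation K f).log, by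
    rw [neg_neg, WithZero.exp_log ((Valuation.ne_zero_iff _).mpr hf)]⟩

theorem exists_add_eq_of_exp_le_valuation_mul (z : HeightOneSpectrum R) {f g : K} {c : ℤ}
    (h : WithZero.exp (-c) ≤ z.valuation K (f * g)) :
    ∃ a b, a + b = c ∧ WithZero.exp (-a) ≤ z.valuation K f ∧
      WithZero.exp (-b) ≤ z.valuation K g := by
  have hfg : f * g ≠ 0 :=
    (Valuation.ne_zero_iff _).mp (WithZero.exp_pos.trans_le h).ne'
  obtain ⟨a, ha⟩ := exists_valuation_eq_exp z (left_ne_zero_of_mul hfg)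
  refine ⟨a, c - a, by ring, ha.ge, ?_⟩
  rw [map_mul, ha, show -c = -a + -(c - a) by ring, WithZero.exp_add] at h
  exact le_of_mul_le_mul_left h WithZero.exp_pos

theorem exists_valuation_eq_exp_and_pow_eq (z : HeightOneSpectrum R) {N : ℕ} (hN : 0 < N) {c : ℤ}
    {g : K} (hg : WithZero.exp (-(N • c)) ≤ z.valuation K g) :
    ∃ (f : K) (r : R), z.valuation K f = WithZero.exp (-c) ∧ f ^ N = algebraMap R K r * g := by
  have hg0 : g ≠ 0 := (Valuation.ne_zero_iff _).mp (WithZero.exp_pos.trans_le hg).ne'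
  obtain ⟨u, hu⟩ := z.valuation_surjective K (WithZero.exp (-c))
  have hv : z.valuation K (u ^ N / g) ≤ 1 := by
    rw [map_div₀, map_pow, hu, ← WithZero.exp_nsmul, smul_neg]
    exact div_le_one_of_le₀ hg zero_le
  obtain ⟨r, d, hrd⟩ := z.exists_primeCompl_mul_eq_of_integer _ hv
  refine ⟨algebraMap R K d * u, d ^ (N - 1) * r, ?_, ?_⟩
  · rw [map_mul, (z.valuation_eq_one_iff_notMem).mpr d.2, one_mul, hu]
  · rw [map_mul, ← hrd, map_pow, mul_pow, ← pow_sub_one_mul hN.ne']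
    field_simp

/-- The pairs `(m, c)` such that some element of `J` has a component of degree `m` and of order
at most `c` at `z`. -/
def orders (z : HeightOneSpectrum R) (J : Ideal A) : Set (M × ℤ) :=
  {x | ∃ F ∈ J, WithZero.exp (-x.2) ≤ z.valuation K ((F : AddMonoidAlgebra K M).coeff x.1)}

theorem zero_mem_orders_top (z : HeightOneSpectrum R) : (0 : M × ℤ) ∈ orders z (⊤ : Ideal A) :=
  ⟨1, trivial, by simp [AddMonoidAlgebra.one_def]⟩

theorem orders_mul_subset (z : HeightOneSpectrum R) (I J : Ideal A) :
    orders z (I * J) ⊆ orders z I + orders z J := by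
  rintro ⟨m, c⟩ ⟨F, hF, hx⟩
  induction hF using Submodule.mul_induction_on' with
  | mem_mul_mem a ha b hb =>
    obtain ⟨m₁, m₂, rfl, hm⟩ := exists_le_valuation_coeff_mul_coeff _ WithZero.exp_ne_zero hx
    obtain ⟨c₁, c₂, rfl, h₁, h₂⟩ := exists_add_eq_of_exp_le_valuation_mul z hm
    exact ⟨(m₁, c₁), ⟨a, ha, h₁⟩, (m₂, c₂), ⟨b, hb, h₂⟩, rfl⟩
  | add F _ G _ hF hG =>
    obtain h | h := le_max_iff.mp (hx.trans (Valuation.map_add _ _ _))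
    exacts [hF h, hG h]

theorem exists_sum_eq_of_mem_orders_pow {z : HeightOneSpectrum R} {J : Ideal A} {s : ℕ}
    (hs : 1 ≤ s) {x : M × ℤ} (hx : x ∈ orders z (J ^ s)) :
    ∃ f : Fin s → M × ℤ, (∀ j, f j ∈ orders z J) ∧ ∑ j, f j = x := by
  induction s, hs using Nat.le_induction generalizing x with
  | base => exact ⟨fun _ => x, fun _ => by simpa using hx, by simp⟩
  | succ s _ ih =>
    rw [pow_succ] at hx
    obtain ⟨a, ha, b, hb, rfl⟩ := orders_mul_subset z _ _ hx
    obtain ⟨f, hf, rfl⟩ := ih ha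
    exact ⟨Fin.snoc f b, Fin.lastCases (by simpa using hb) (by simpa using hf),
      by simp [Fin.sum_univ_castSucc]⟩

variable [DecidableEq M] [GradedRing (gradedPiece A)] {I J : Ideal A}

theorem exists_mem_eq_single_of_mem_orders (hJ : J.IsHomogeneous (gradedPiece A))
    {z : HeightOneSpectrum R} {x : M × ℤ} (hx : x ∈ orders z J) :
    ∃ G ∈ J, ∃ f : K, (G : AddMonoidAlgebra K M) = .single x.1 f ∧
      WithZero.exp (-x.2) ≤ z.valuation K f := by
  obtain ⟨F, hF, hx⟩ := hx
  exact ⟨_, hJ x.1 hF, _, coe_decompose F x.1, hx⟩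

theorem add_mem_orders_mul (hI : I.IsHomogeneous (gradedPiece A))
    (hJ : J.IsHomogeneous (gradedPiece A)) {z : HeightOneSpectrum R} {x y : M × ℤ}
    (hx : x ∈ orders z I) (hy : y ∈ orders z J) : x + y ∈ orders z (I * J) := by
  obtain ⟨F, hF, f, hFf, hx⟩ := exists_mem_eq_single_of_mem_orders hI hx
  obtain ⟨G, hG, g, hGg, hy⟩ := exists_mem_eq_single_of_mem_orders hJ hy
  refine ⟨F * G, Ideal.mul_mem_mul hF hG, ?_⟩
  rw [Subalgebra.coe_mul, hFf, hGg, AddMonoidAlgebra.single_mul_single,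
    AddMonoidAlgebra.coeff_single, Prod.fst_add, Finsupp.single_eq_same, map_mul, Prod.snd_add,
    neg_add, WithZero.exp_add]
  exact mul_le_mul' hx hy

theorem sum_mem_orders_pow (hJ : J.IsHomogeneous (gradedPiece A)) {z : HeightOneSpectrum R}
    {s : ℕ} {f : Fin s → M × ℤ} (hf : ∀ j, f j ∈ orders z J) : ∑ j, f j ∈ orders z (J ^ s) := by
  induction s with
  | zero =>
    rw [Fin.sum_univ_zero, pow_zero, Ideal.one_eq_top]
    exact zero_mem_orders_top z
  | succ s ih =>
    rw [Fin.sum_univ_castSucc, pow_succ]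
    exact add_mem_orders_mul (isHomogeneous_pow _ hJ s) hJ (ih fun j => hf _) (hf _)

theorem exists_notMem_smul_mem_of_mem_orders (hJ : J.IsHomogeneous (gradedPiece A))
    {z : HeightOneSpectrum R} {m : M} {c : ℤ} (hmc : (m, c) ∈ orders z J) {G : A} {f : K}
    (hG : (G : AddMonoidAlgebra K M) = .single m f)
    (hf : z.valuation K f ≤ WithZero.exp (-c)) :
    ∃ d ∉ z.asIdeal, d • G ∈ J := by
  obtain ⟨H, hH, g, hHg, hle⟩ := exists_mem_eq_single_of_mem_orders hJ hmc
  have hg : g ≠ 0 := (Valuation.ne_zero_iff _).mp (WithZero.exp_pos.trans_le hle).ne'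
  have hv : z.valuation K (f / g) ≤ 1 := by
    rw [map_div₀]
    exact div_le_one_of_le₀ (hf.trans hle) zero_le
  obtain ⟨r, d, hrd⟩ := z.exists_primeCompl_mul_eq_of_integer (f / g) hv
  have hdG : (d : R) • G = r • H := by
    refine Subtype.ext ?_
    rw [Subalgebra.coe_smul, Subalgebra.coe_smul, hG, hHg, AddMonoidAlgebra.smul_single,
      AddMonoidAlgebra.smul_single, Algebra.smul_def, Algebra.smul_def, ← hrd]
    congr 1
    field_simp
  exact ⟨d, d.2, hdG ▸ (J.restrictScalars R).smul_mem r hH⟩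

theorem mem_of_forall_exists_smul_mem {R A : Type*} [CommRing R] [IsDedekindDomain R]
    (hR : ¬ IsField R) [AddCommGroup A] [Module R A] (J : Submodule R A) {G : A}
    (h : ∀ z : HeightOneSpectrum R, ∃ d ∉ z.asIdeal, d • G ∈ J) : G ∈ J := by
  suffices hT : J.comap (LinearMap.toSpanSingleton R A G) = ⊤ by
    have h1 : (1 : R) ∈ J.comap (LinearMap.toSpanSingleton R A G) := hT ▸ trivial
    simpa using h1
  by_contra hne
  obtain ⟨p, hp, hle⟩ := Ideal.exists_le_maximal _ hne
  obtain ⟨d, hd, hdG⟩ := h ⟨p, hp.isPrime, Ring.ne_bot_of_isMaximal_of_not_isField hp hR⟩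
  exact hd (hle hdG)

theorem le_of_forall_orders_subset (hR : ¬ IsField R) (hJ : J.IsHomogeneous (gradedPiece A))
    (h : ∀ z, orders z I ⊆ orders z J) : I ≤ J := by
  intro F hF
  rw [hJ.mem_iff]
  intro m
  by_cases hf : (F : AddMonoidAlgebra K M).coeff m = 0
  · have h0 : (decompose (gradedPiece A) F m : A) = 0 := by
      refine Subtype.ext ?_
      rw [coe_decompose, hf, AddMonoidAlgebra.single_zero]
      rfl
    exact h0 ▸ J.zero_mem
  · refine mem_of_forall_exists_smul_mem hR (J.restrictScalars R) fun z => ?_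
    obtain ⟨c, hc⟩ := exists_valuation_eq_exp z hf
    exact exists_notMem_smul_mem_of_mem_orders hJ (h z ⟨F, hF, hc.ge⟩) (coe_decompose F m) hc.le

end Orders

section IntegralClosureOrders

open DirectSum IsDedekindDomain

theorem isIntegralOverIdeal_of_pow_mem {A : Type*} [CommRing A] {J : Ideal A} {a : A} {N : ℕ}
    (hN : 1 ≤ N) (ha : a ^ N ∈ J ^ N) : IsIntegralOverIdeal J a := by
  refine ⟨N, hN, Pi.single N (-a ^ N), fun i _ => ?_, ?_⟩
  · obtain rfl | hi := eq_or_ne i N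
    · simpa using ha
    · simp [hi]
  · rw [Finset.sum_eq_single_of_mem N (Finset.mem_Icc.mpr ⟨hN, le_rfl⟩)
      fun i _ hi => by simp [hi]]
    simp

theorem coeff_nsmul_mul_single_pow {K M : Type*} [Field K] [AddCommGroup M]
    (F : AddMonoidAlgebra K M) (m : M) (f : K) {i r : ℕ} (hi : i ≤ r) :
    (F * .single m f ^ (r - i)).coeff (r • m) = F.coeff (i • m) * f ^ (r - i) := by
  rw [AddMonoidAlgebra.single_pow, AddMonoidAlgebra.coeff_mul_single_apply]
  congr 2
  rw [← sub_eq_add_neg, sub_eq_iff_eq_add, ← add_nsmul, Nat.add_sub_cancel' hi]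

variable {R K M : Type*} [CommRing R] [IsDedekindDomain R] [Field K] [Algebra R K]
  [IsFractionRing R K] [AddCommGroup M] {A : Subalgebra R (AddMonoidAlgebra K M)}

/-- The subalgebra `A` of `K[M]` contains the monomials having a positive power in `A`. -/
def IsRootClosed (A : Subalgebra R (AddMonoidAlgebra K M)) : Prop :=
  ∀ (N : ℕ) (m : M) (f : K), 0 < N → AddMonoidAlgebra.single (N • m) (f ^ N) ∈ A →
    AddMonoidAlgebra.single m f ∈ A

variable [DecidableEq M] [GradedRing (gradedPiece A)] {J : Ideal A}

theorem mem_orders_idealClosure (hA : IsRootClosed A) (hJ : J.IsHomogeneous (gradedPiece A))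
    {z : HeightOneSpectrum R} {x : M × ℤ} {N : ℕ} (hN : 0 < N) (hx : N • x ∈ orders z (J ^ N)) :
    x ∈ orders z (idealClosure J) := by
  obtain ⟨G, hG, g, hGg, hx⟩ := exists_mem_eq_single_of_mem_orders (isHomogeneous_pow _ hJ N) hx
  obtain ⟨f, r, hf, hfg⟩ := exists_valuation_eq_exp_and_pow_eq z hN hx
  have hrG : ((r • G : A) : AddMonoidAlgebra K M) = .single (N • x.1) (f ^ N) := by
    rw [Subalgebra.coe_smul, hGg, AddMonoidAlgebra.smul_single, Algebra.smul_def, ← hfg,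
      Prod.smul_fst]
  let F : A := ⟨.single x.1 f, hA N x.1 f hN (hrG ▸ (r • G).2)⟩
  have hF : F ^ N = r • G := by
    refine Subtype.ext ?_
    rw [hrG, Subalgebra.coe_pow, AddMonoidAlgebra.single_pow]
  refine ⟨F, isIntegralOverIdeal_of_pow_mem hN (hF ▸ ?_), ?_⟩
  · exact ((J ^ N).restrictScalars R).smul_mem r hG
  · rw [AddMonoidAlgebra.coeff_single, Finsupp.single_eq_same, hf]

variable [Module.Free ℤ M] [Module.Finite ℤ M]

theorem exists_nsmul_mem_orders_pow (hJ : J.IsHomogeneous (gradedPiece A))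
    {z : HeightOneSpectrum R} {x : M × ℤ} (hx : x ∈ orders z (idealClosure J)) :
    ∃ N, 0 < N ∧ N • x ∈ orders z (J ^ N) := by
  obtain ⟨m, c⟩ := x
  obtain ⟨G, ⟨r, _, l, hl, h⟩, f, hGf, hle⟩ :=
    exists_mem_eq_single_of_mem_orders (isHomogeneous_idealClosure _ hJ) hx
  have hf : f ≠ 0 := (Valuation.ne_zero_iff _).mp (WithZero.exp_pos.trans_le hle).ne'
  have hcoeff : f ^ r + ∑ i ∈ Finset.Icc 1 r,
      (l i : AddMonoidAlgebra K M).coeff (i • m) * f ^ (r - i) = 0 := by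
    have h := congrArg (fun a : A => (a : AddMonoidAlgebra K M).coeff (r • m)) h
    push_cast at h
    rw [hGf, AddMonoidAlgebra.coeff_add, Finsupp.add_apply, AddMonoidAlgebra.coeff_sum,
      Finsupp.finsetSum_apply, AddMonoidAlgebra.single_pow, AddMonoidAlgebra.coeff_single,
      Finsupp.single_eq_same] at h
    rw [← Finset.sum_congr rfl fun i hi =>
      coeff_nsmul_mul_single_pow _ m f (Finset.mem_Icc.mp hi).2]
    exact h
  obtain ⟨i, hi, hlt⟩ :=
    exists_valuation_pow_le_of_pow_add_sum_eq_zero (z.valuation K) hf hcoeff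
  refine ⟨i, (Finset.mem_Icc.mp hi).1, l i, hl i hi, le_trans ?_ hlt⟩
  rw [Prod.smul_snd, ← smul_neg, WithZero.exp_nsmul]
  exact pow_le_pow_left₀ zero_le hle i

end IntegralClosureOrders

section ReesMonoid

open IsDedekindDomain

variable {R K M : Type*} [CommRing R] [IsDedekindDomain R] [Field K] [Algebra R K]
  [IsFractionRing R K] [AddCommGroup M] {A : Subalgebra R (AddMonoidAlgebra K M)}

/-- The elements of degree `0` and `1` of the monoid `{((m, c), e) | (m, c) ∈ orders z (I ^ e)}` of
the Rees algebra of `I` at the point `z`. -/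
def reesGenerators (z : HeightOneSpectrum R) (I : Ideal A) : Set ((M × ℤ) × ℤ) :=
  {y | y.1 ∈ orders z (⊤ : Ideal A) ∧ y.2 = 0 ∨ y.1 ∈ orders z I ∧ y.2 = 1}

/-- The monoid of the Rees algebra of `I` at the point `z`, generated in degrees `0` and `1`. -/
def reesMonoid (z : HeightOneSpectrum R) (I : Ideal A) : AddSubmonoid ((M × ℤ) × ℤ) :=
  AddSubmonoid.closure (reesGenerators z I)

variable {z : HeightOneSpectrum R} {I J : Ideal A} {x : M × ℤ} {e : ℕ}

theorem exists_sub_mem_saturation_reesMonoid [Module.Free ℤ M] [Module.Finite ℤ M] {j : ℕ}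
    (he : Module.finrank ℤ M ≤ e) (hx : (x, ((e + j : ℕ) : ℤ)) ∈ saturation (reesMonoid z I)) :
    ∃ y, (y, (j : ℤ)) ∈ saturation (reesMonoid z I) ∧
      (x - y, (e : ℤ)) ∈ saturation (reesMonoid z I) := by
  induction j generalizing x with
  | zero => exact ⟨0, zero_mem _, by simpa using hx⟩
  | succ j ih =>
    obtain ⟨⟨v, _⟩, hv : _ ∈ saturation (reesMonoid z I), rfl, hxv⟩ :=
      exists_sub_mem_saturation_closure (AddMonoidHom.snd (M × ℤ) ℤ) (G := reesGenerators z I)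
        (fun g hg => hg.imp And.right And.right) (d := Module.finrank ℤ M + 1)
        (by simp [Module.finrank_prod]) (by simp) hx (by simp; lia)
    obtain ⟨y, hy, hxy⟩ := ih (x := x - v) (by simpa [reesMonoid, ← add_assoc] using hxv)
    exact ⟨v + y, by simpa [add_comm] using add_mem hv hy, by rwa [← sub_sub]⟩

variable [DecidableEq M] [GradedRing (gradedPiece A)]

theorem exists_mem_orders_pow_of_mem_reesMonoid (hI : I.IsHomogeneous (gradedPiece A))
    {y : (M × ℤ) × ℤ} (hy : y ∈ reesMonoid z I) : ∃ e : ℕ, y.2 = e ∧ y.1 ∈ orders z (I ^ e) := by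
  induction hy using AddSubmonoid.closure_induction with
  | mem y hy =>
    obtain ⟨hy, h0⟩ | ⟨hy, h1⟩ := hy
    · exact ⟨0, by simpa using h0, by simpa using hy⟩
    · exact ⟨1, by simpa using h1, by simpa using hy⟩
  | zero => exact ⟨0, rfl, by simpa using zero_mem_orders_top z⟩
  | add y y' _ _ hy hy' =>
    obtain ⟨a, ha, hy⟩ := hy
    obtain ⟨b, hb, hy'⟩ := hy'
    refine ⟨a + b, by simp [ha, hb], ?_⟩
    rw [pow_add]
    exact add_mem_orders_mul (isHomogeneous_pow _ hI a) (isHomogeneous_pow _ hI b) hy hy'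

theorem mk_mem_reesMonoid_iff (hI : I.IsHomogeneous (gradedPiece A)) :
    (x, (e : ℤ)) ∈ reesMonoid z I ↔ x ∈ orders z (I ^ e) := by
  refine ⟨fun h => ?_, fun h => ?_⟩
  · obtain ⟨e', he', h⟩ := exists_mem_orders_pow_of_mem_reesMonoid hI h
    obtain rfl : e = e' := by simpa using he'
    exact h
  · induction e generalizing x with
    | zero => exact AddSubmonoid.subset_closure (.inl ⟨by simpa using h, rfl⟩)
    | succ e ih =>
      rw [pow_succ] at h
      obtain ⟨a, ha, b, hb, rfl⟩ := orders_mul_subset z _ _ h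
      exact add_mem (ih ha) (AddSubmonoid.subset_closure (.inr ⟨hb, rfl⟩) :
        (b, (1 : ℤ)) ∈ reesMonoid z I)

theorem mk_mem_saturation_reesMonoid_iff (hI : I.IsHomogeneous (gradedPiece A)) :
    (x, (e : ℤ)) ∈ saturation (reesMonoid z I) ↔
      ∃ N, 0 < N ∧ N • x ∈ orders z (I ^ (N * e)) := by
  refine exists_congr fun N => and_congr_right fun _ => ?_
  rw [← mk_mem_reesMonoid_iff hI, Prod.smul_mk, nsmul_eq_mul, Nat.cast_mul]

variable [Module.Free ℤ M] [Module.Finite ℤ M]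

theorem mem_saturation_reesMonoid_of_mem_orders (hI : I.IsHomogeneous (gradedPiece A))
    (hx : x ∈ orders z (idealClosure (I ^ e))) : (x, (e : ℤ)) ∈ saturation (reesMonoid z I) := by
  obtain ⟨N, hN, h⟩ := exists_nsmul_mem_orders_pow (isHomogeneous_pow _ hI e) hx
  exact (mk_mem_saturation_reesMonoid_iff hI).mpr ⟨N, hN, by rwa [mul_comm, pow_mul]⟩

theorem mem_orders_idealClosure_pow_iff (hA : IsRootClosed A)
    (hI : I.IsHomogeneous (gradedPiece A)) :
    x ∈ orders z (idealClosure (I ^ e)) ↔ (x, (e : ℤ)) ∈ saturation (reesMonoid z I) := by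
  refine ⟨mem_saturation_reesMonoid_of_mem_orders hI, fun h => ?_⟩
  obtain ⟨N, hN, h⟩ := (mk_mem_saturation_reesMonoid_iff hI).mp h
  rw [mul_comm, pow_mul] at h
  exact mem_orders_idealClosure hA (isHomogeneous_pow _ hI e) hN h

theorem isNormalIdeal_of_saturation_reesMonoid (hR : ¬ IsField R)
    (hJ : J.IsHomogeneous (gradedPiece A))
    (h : ∀ (z : HeightOneSpectrum R) (s : ℕ), 1 ≤ s → ∀ x : M × ℤ,
      (x, (s : ℤ)) ∈ saturation (reesMonoid z J) → x ∈ orders z (J ^ s)) :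
    IsNormalIdeal J := fun s hs =>
  le_of_forall_orders_subset hR (isHomogeneous_pow _ hJ s) fun z x hx =>
    h z s hs x (mem_saturation_reesMonoid_of_mem_orders hJ hx)

theorem mk_mul_mem_saturation_reesMonoid (hI : I.IsHomogeneous (gradedPiece A)) {s : ℤ}
    (hx : (x, s) ∈ saturation (reesMonoid z (idealClosure (I ^ e)))) :
    (x, e * s) ∈ saturation (reesMonoid z I) := by
  have hle : reesMonoid z (idealClosure (I ^ e)) ≤ (saturation (reesMonoid z I)).comap
      ((AddMonoidHom.id (M × ℤ)).prodMap (AddMonoidHom.mulLeft (e : ℤ))) := by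
    refine AddSubmonoid.closure_le.mpr ?_
    rintro ⟨y, _⟩ (⟨hy, rfl⟩ | ⟨hy, rfl⟩)
    · exact le_saturation _ (AddSubmonoid.subset_closure (.inl ⟨hy, by simp⟩))
    · simpa using mem_saturation_reesMonoid_of_mem_orders hI hy
  obtain ⟨N, hN, hx⟩ := hx
  refine mem_saturation_of_nsmul_mem_saturation hN ?_
  simpa [mul_left_comm] using hle hx

/-- Since `finrank ℤ M ≤ e`, elements of degree `s * e` of the saturated Rees monoid of `I` are sums
of `s` elements of degree `e`, which are orders of elements of the integral closure of `I ^ e`. -/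
theorem isNormalIdeal_idealClosure_pow (hR : ¬ IsField R) (hA : IsRootClosed A)
    (hI : I.IsHomogeneous (gradedPiece A)) (he : Module.finrank ℤ M ≤ e) :
    IsNormalIdeal (idealClosure (I ^ e)) := by
  have hJ := isHomogeneous_idealClosure _ (isHomogeneous_pow _ hI e)
  refine isNormalIdeal_of_saturation_reesMonoid hR hJ fun z s hs x hx => ?_
  replace hx := mk_mul_mem_saturation_reesMonoid hI hx
  induction s, hs using Nat.le_induction generalizing x with
  | base =>
    rw [pow_one, mem_orders_idealClosure_pow_iff hA hI]
    simpa using hx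
  | succ s hs ih =>
    obtain ⟨y, hy, hxy⟩ := exists_sub_mem_saturation_reesMonoid (e := e * s) (j := e)
      (he.trans (Nat.le_mul_of_pos_right e hs)) (by push_cast at hx ⊢; rwa [← mul_add_one])
    rw [← mem_orders_idealClosure_pow_iff hA hI] at hy
    rw [pow_succ, ← sub_add_cancel x y]
    exact add_mem_orders_mul (isHomogeneous_pow _ hJ s) hJ (ih _ (by simpa using hxy)) hy

end ReesMonoid

/-! ### Polyhedral divisors -/

section LatticePolyhedra

variable {ι : Type*}

theorem castQ_nsmul (N : ℕ) (m : ι → ℤ) : castQ (N • m) = (N : ℚ) • castQ m := by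
  ext i; simp [castQ]

theorem castQ_sum {α : Type*} (s : Finset α) (f : α → ι → ℤ) :
    castQ (∑ j ∈ s, f j) = ∑ j ∈ s, castQ (f j) := by
  ext i; simp [castQ]

theorem castQ_extend (m : ι → ℤ) (c : ℤ) : castQ (extend m c) = extend (castQ m) (c : ℚ) := by
  ext (i | i) <;> rfl

theorem extend_comp_inl {S : Type*} (x : ι ⊕ Unit → S) :
    extend (x ∘ Sum.inl) (x (Sum.inr ())) = x := by
  ext (i | i) <;> rfl

theorem extend_add {S : Type*} [Add S] (v w : ι → S) (p q : S) :
    extend (v + w) (p + q) = extend v p + extend w q := by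
  ext (i | i) <;> rfl

theorem smul_extend {S : Type*} [Mul S] (a : S) (v : ι → S) (p : S) :
    a • extend v p = extend (a • v) (a * p) := by
  ext (i | i) <;> rfl

theorem sum_extend {S α : Type*} [AddCommMonoid S] (s : Finset α) (v : α → ι → S) (p : α → S) :
    ∑ j ∈ s, extend (v j) (p j) = extend (∑ j ∈ s, v j) (∑ j ∈ s, p j) := by
  ext (i | i) <;> simp [extend]

theorem sum_comp_inl {S α : Type*} [AddCommMonoid S] (s : Finset α) (f : α → ι ⊕ Unit → S) :
    (∑ j ∈ s, f j) ∘ Sum.inl = ∑ j ∈ s, f j ∘ Sum.inl := by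
  ext i; simp

theorem sum_mem_natCast_smul {C : Set (ι → ℚ)} (hC : Convex ℚ C) {s : ℕ} (hs : 1 ≤ s)
    {f : Fin s → ι → ℚ} (hf : ∀ j, f j ∈ C) : ∑ j, f j ∈ (s : ℚ) • C := by
  have hs0 : (s : ℚ) ≠ 0 := by positivity
  refine ⟨∑ j, (s : ℚ)⁻¹ • f j, hC.sum_mem (fun _ _ => by positivity) ?_ fun j _ => hf j, ?_⟩
  · simp [hs0]
  · simp only [← Finset.smul_sum, smul_inv_smul₀ hs0]

theorem castQ_mem_smul_of_sum_eq_nsmul {C : Set (ι → ℚ)} (hC : Convex ℚ C) {N s : ℕ} (hN : 1 ≤ N)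
    (hs : 1 ≤ s) {x : ι → ℤ} {f : Fin (N * s) → ι → ℤ} (hf : ∀ j, castQ (f j) ∈ C)
    (h : ∑ j, f j = N • x) : castQ x ∈ (s : ℚ) • C := by
  have hsum := sum_mem_natCast_smul hC (Nat.mul_pos hN hs) hf
  rwa [← castQ_sum, h, castQ_nsmul, Nat.cast_mul, mul_smul,
    Set.smul_mem_smul_set_iff₀ (by positivity)] at hsum

theorem isNormalPolyhedron_of_convex {C : Set (ι → ℚ)} (hC : Convex ℚ C)
    (h : ∀ s : ℕ, 1 ≤ s → ∀ m : ι → ℤ, castQ m ∈ (s : ℚ) • C →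
      ∃ f : Fin s → (ι → ℤ), (∀ j, castQ (f j) ∈ C) ∧ ∑ j, f j = m) : IsNormalPolyhedron C := by
  refine fun s hs m => ⟨h s hs m, ?_⟩
  rintro ⟨f, hf, rfl⟩
  rw [castQ_sum]
  exact sum_mem_natCast_smul hC hs hf

theorem extend_dotProduct [Fintype ι] (v : ι → ℚ) (p : ℚ) (w : ι ⊕ Unit → ℚ) :
    extend v p ⬝ᵥ w = v ⬝ᵥ (w ∘ Sum.inl) + p * w (Sum.inr ()) := by
  simp [extend, dotProduct]

theorem IsTailedPolyhedron.convex {F : Set (ι → ℚ)} {τ : PointedCone ℚ (ι → ℚ)} {P : Set (ι → ℚ)}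
    (hP : IsTailedPolyhedron F τ P) : Convex ℚ P := by
  obtain ⟨Q, -, -, rfl⟩ := hP
  exact (convex_convexHull ℚ _).add τ.toConvexCone.convex

variable [Finite ι]

theorem exists_smul_eq_castQ (v : ι → ℚ) : ∃ N : ℕ, 0 < N ∧
    ∃ m : ι → ℤ, (N : ℚ) • v = castQ m := by
  have := Fintype.ofFinite ι
  have hdvd (i : ι) : (v i).den ∣ ∏ j, (v j).den := Finset.dvd_prod_of_mem _ (Finset.mem_univ i)
  choose c hc using hdvd
  refine ⟨∏ j, (v j).den, Finset.prod_pos fun j _ => (v j).den_pos, fun i => c i * (v i).num, ?_⟩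
  ext i
  simp only [Pi.smul_apply, smul_eq_mul, castQ]
  rw [hc i]
  push_cast
  rw [← Rat.mul_den_eq_num (v i)]
  ring

theorem subset_convexHull_castQ (τ : PointedCone ℚ (ι → ℚ)) :
    (τ : Set (ι → ℚ)) ⊆ convexHull ℚ ((τ : Set (ι → ℚ)) ∩ Set.range castQ) := by
  intro v hv
  obtain ⟨N, hN, m, hm⟩ := exists_smul_eq_castQ v
  have hNv : (N : ℚ) • v ∈ (τ : Set (ι → ℚ)) ∩ Set.range castQ :=
    ⟨τ.smul_mem N.cast_nonneg hv, m, hm.symm⟩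
  have h0 : (0 : ι → ℚ) ∈ (τ : Set (ι → ℚ)) ∩ Set.range castQ :=
    ⟨τ.zero_mem, 0, by ext i; simp [castQ]⟩
  refine segment_subset_convexHull h0 hNv ?_
  have hN' : (1 : ℚ) ≤ N := by exact_mod_cast hN
  exact ⟨1 - (N : ℚ)⁻¹, (N : ℚ)⁻¹, sub_nonneg.mpr (inv_le_one_of_one_le₀ hN'), by positivity,
    sub_add_cancel _ _, by rw [smul_zero, zero_add, inv_smul_smul₀ (by positivity)]⟩

theorem IsTailedPolyhedron.subset_convexHull_castQ {F : Set (ι → ℚ)} {τ : PointedCone ℚ (ι → ℚ)}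
    {P : Set (ι → ℚ)} (hP : IsTailedPolyhedron F τ P) (hF : F ⊆ Set.range castQ) :
    P ⊆ convexHull ℚ (P ∩ Set.range castQ) := by
  obtain ⟨Q, -, hQ, rfl⟩ := hP
  refine (Set.add_subset_add_left (ComplexityOne.subset_convexHull_castQ τ)).trans ?_
  rw [← convexHull_add]
  refine convexHull_mono ?_
  rintro _ ⟨q, hq, _, ⟨hv, m, rfl⟩, rfl⟩
  obtain ⟨m', rfl⟩ := hF (hQ hq)
  exact ⟨⟨_, subset_convexHull ℚ _ hq, _, hv, rfl⟩, m' + m, by ext i; simp [castQ]⟩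

end LatticePolyhedra

section GlobalSections

open IsDedekindDomain

variable {R : Type*} [CommRing R] [IsDedekindDomain R]
variable {K : Type*} [Field K] [Algebra R K] [IsFractionRing R K]

theorem exists_notMem_valuation_algebraMap_mul_le {y z : HeightOneSpectrum R} (hyz : y ≠ z) (u : K)
    (n : ℤ) : ∃ a ∉ z.asIdeal, y.valuation K (algebraMap R K a * u) ≤ WithZero.exp n := by
  have hle : ¬ y.asIdeal ≤ z.asIdeal := fun hle =>
    hyz (HeightOneSpectrum.ext (y.isMaximal.eq_of_le z.isPrime.ne_top hle))
  obtain ⟨a, hay, haz⟩ := Set.not_subset.mp hle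
  obtain rfl | hu := eq_or_ne u 0
  · exact ⟨a, haz, by simp⟩
  have hpow (N : ℕ) : y.valuation K (algebraMap R K (a ^ N)) ≤ WithZero.exp (-(N : ℤ)) :=
    (y.valuation_of_algebraMap _).trans_le
      ((y.intValuation_le_pow_iff_mem _ N).mpr (Ideal.pow_mem_pow hay N))
  obtain ⟨c, hc⟩ := exists_valuation_eq_exp y hu
  refine ⟨a ^ (-c - n).toNat, fun h => haz (z.isPrime.mem_of_pow_mem _ h), ?_⟩
  rw [map_mul, hc]
  refine (mul_le_mul_left (hpow _) _).trans ?_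
  rw [← WithZero.exp_add, WithZero.exp_le_exp]
  lia

theorem exists_mem_globalSections_valuation_eq {D : HeightOneSpectrum R → ℚ}
    (hD : {y | D y ≠ 0}.Finite) (z : HeightOneSpectrum R) :
    ∃ g ∈ globalSections K D, z.valuation K g = WithZero.exp ⌊D z⌋ := by
  classical
  obtain ⟨u, hu⟩ := z.valuation_surjective K (WithZero.exp ⌊D z⌋)
  have hfin : ({y | D y ≠ 0} ∪ {y : HeightOneSpectrum R | 1 < y.valuation K u}).Finite :=
    hD.union (HeightOneSpectrum.Support.finite R u)
  have hex (y : HeightOneSpectrum R) : ∃ a : R, a ∉ z.asIdeal ∧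
      (y ≠ z → y.valuation K (algebraMap R K a * u) ≤ WithZero.exp ⌊D y⌋) := by
    obtain rfl | hyz := eq_or_ne y z
    · exact ⟨1, (Ideal.ne_top_iff_one _).mp y.isPrime.ne_top, fun h => absurd rfl h⟩
    · obtain ⟨a, ha, hle⟩ := exists_notMem_valuation_algebraMap_mul_le hyz u ⌊D y⌋
      exact ⟨a, ha, fun _ => hle⟩
  choose a haz ha using hex
  have hunit : z.valuation K (algebraMap R K (∏ y ∈ hfin.toFinset, a y)) = 1 :=
    z.valuation_eq_one_iff_notMem.mpr fun h =>
      have ⟨y, _, hy⟩ := z.isPrime.prod_mem_iff.mp h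
      haz y hy
  refine ⟨algebraMap R K (∏ y ∈ hfin.toFinset, a y) * u, fun y => ?_, by
    rw [map_mul, hu, hunit, one_mul]⟩
  obtain rfl | hyz := eq_or_ne y z
  · rw [map_mul, hu, hunit, one_mul]
  by_cases hy : y ∈ hfin.toFinset
  · rw [← Finset.mul_prod_erase _ _ hy, mul_comm (a y), map_mul (algebraMap R K), mul_assoc,
      map_mul (y.valuation K)]
    exact (mul_le_of_le_one_left' (y.valuation_le_one _)).trans (ha y hyz)
  · simp only [Set.Finite.mem_toFinset, Set.mem_union, Set.mem_ofPred_eq, not_or, not_not,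
      not_lt] at hy
    rw [map_mul, hy.1, Int.floor_zero, WithZero.exp_zero]
    exact mul_le_one' (y.valuation_le_one _) hy.2

end GlobalSections

namespace PolyhedralDivisor

open IsDedekindDomain

variable {R : Type*} [CommRing R] {ι : Type*} [Fintype ι]

theorem eval_nsmul {σ : PointedCone ℚ (ι → ℚ)} (D : PolyhedralDivisor R σ) {m : ι → ℤ}
    (hm : castQ m ∈ dualCone (σ : Set (ι → ℚ))) (N : ℕ) (z : HeightOneSpectrum R) :
    D.eval (N • m) z = N * D.eval m z := by
  have h := (D.isTailedPolyhedron z).isLeast_supportFn hm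
  have hN : Monotone fun a : ℚ => (N : ℚ) * a := fun a b hab =>
    mul_le_mul_of_nonneg_left hab N.cast_nonneg
  refine supportFn_eq ?_
  simpa only [Set.image_image, castQ_nsmul, smul_dotProduct, smul_eq_mul, eval] using
    hN.map_isLeast h

section LocalPolyhedron

variable {τ : PointedCone ℚ (ι ⊕ Unit → ℚ)} {D' : PolyhedralDivisor R τ} {P : Set (ι → ℚ)}
  {z : HeightOneSpectrum R}

theorem castQ_extend_mem_localPolyhedron {m : ι → ℤ} {c : ℤ} (hm : castQ m ∈ P)
    (hc : -(c : ℚ) ≤ D'.eval (extend m 1) z) : castQ (extend m c) ∈ D'.localPolyhedron P z :=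
  subset_convexHull ℚ _ ⟨m, c, rfl, hm, hc⟩

theorem comp_inl_mem_of_mem_localPolyhedron (hP : Convex ℚ P) {x : ι ⊕ Unit → ℚ}
    (hx : x ∈ D'.localPolyhedron P z) : x ∘ Sum.inl ∈ P := by
  refine convexHull_min ?_ (hP.linear_preimage (LinearMap.funLeft ℚ ℚ Sum.inl)) hx
  rintro _ ⟨m, i, rfl, hm, -⟩
  exact hm

theorem eventually_extend_mem_localPolyhedron {v : ι → ℚ}
    (hv : v ∈ convexHull ℚ (P ∩ Set.range castQ)) :
    ∀ᶠ c : ℤ in Filter.atTop, extend v (c : ℚ) ∈ D'.localPolyhedron P z := by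
  refine convexHull_min (t := {v | ∀ᶠ c : ℤ in Filter.atTop, extend v (c : ℚ) ∈
    D'.localPolyhedron P z}) ?_ (fun v hv w hw a b ha hb hab => ?_) hv
  · rintro _ ⟨hm, m, rfl⟩
    filter_upwards [Filter.eventually_ge_atTop ⌈-D'.eval (extend m 1) z⌉] with c hc
    rw [← castQ_extend]
    exact castQ_extend_mem_localPolyhedron hm (neg_le.mp (Int.ceil_le.mp hc))
  · filter_upwards [hv, hw] with c hcv hcw
    have h := convex_convexHull ℚ _ hcv hcw ha hb hab
    rwa [smul_extend, smul_extend, ← extend_add, ← add_mul, hab, one_mul] at h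

/-- A lattice point of `sP` lifts to one of `s` times the local polyhedron, with large last
coordinate. -/
theorem isNormalPolyhedron_of_localPolyhedron (hP : Convex ℚ P)
    (hPZ : P ⊆ convexHull ℚ (P ∩ Set.range castQ))
    (hz : IsNormalPolyhedron (D'.localPolyhedron P z)) : IsNormalPolyhedron P := by
  refine isNormalPolyhedron_of_convex hP ?_
  rintro s hs m ⟨v, hv, hvm⟩
  obtain ⟨c, hc⟩ := (eventually_extend_mem_localPolyhedron (D' := D') (z := z) (hPZ hv)).exists
  obtain ⟨f, hf, hfm⟩ := (hz s hs (extend m (s * c))).mp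
    ⟨_, hc, by simp only [smul_extend, castQ_extend, ← hvm]; push_cast; rfl⟩
  refine ⟨fun j => f j ∘ Sum.inl, fun j => comp_inl_mem_of_mem_localPolyhedron hP (hf j), ?_⟩
  rw [← sum_comp_inl, hfm]
  rfl

end LocalPolyhedron

section ReesCone

variable {σ : PointedCone ℚ (ι → ℚ)} {P : Set (ι → ℚ)}
  {D' : PolyhedralDivisor R (dualCone (reesCone σ P))} {z : HeightOneSpectrum R}

theorem extend_one_mem_dualCone {m : ι → ℚ} (hm : m ∈ P) :
    extend m 1 ∈ dualCone (dualCone (reesCone σ P) : Set (ι ⊕ Unit → ℚ)) := by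
  rw [mem_dualCone]
  intro w hw
  rw [dotProduct_comm]
  exact mem_dualCone.mp hw _ ⟨m, 1, rfl, .inr ⟨one_pos, by rwa [one_smul]⟩⟩

theorem isLeast_eval_extend_one {m : ι → ℤ} (hm : castQ m ∈ P) :
    IsLeast ((fun w => extend (castQ m) 1 ⬝ᵥ w) '' D'.coeff z) (D'.eval (extend m 1) z) := by
  rw [eval, castQ_extend, Int.cast_one]
  exact (D'.isTailedPolyhedron z).isLeast_supportFn (extend_one_mem_dualCone hm)

theorem eval_extend_one_of_notMem_support (hz : z ∉ D'.support) {m : ι → ℤ} (hm : castQ m ∈ P) :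
    D'.eval (extend m 1) z = 0 := by
  have hz' : D'.coeff z = (dualCone (reesCone σ P) : Set (ι ⊕ Unit → ℚ)) := not_not.mp hz
  refine (isLeast_eval_extend_one hm).unique ⟨⟨0, ?_, dotProduct_zero _⟩, ?_⟩
  · exact hz' ▸ zero_mem (dualCone (reesCone σ P))
  · rintro _ ⟨w, hw, rfl⟩
    exact mem_dualCone.mp (extend_one_mem_dualCone hm) w (hz' ▸ hw)

theorem neg_le_dotProduct_of_extend_mem_localPolyhedron {v : ι → ℚ} {p : ℚ}
    (h : extend v p ∈ D'.localPolyhedron P z) {w : ι ⊕ Unit → ℚ} (hw : w ∈ D'.coeff z) :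
    -p ≤ extend v 1 ⬝ᵥ w := by
  have hC : Convex ℚ {x : ι ⊕ Unit → ℚ | -w (Sum.inr ()) ≤ x ⬝ᵥ extend (w ∘ Sum.inl) 1} :=
    convex_halfSpace_ge ⟨fun x y => add_dotProduct x y _, fun c x => smul_dotProduct c x _⟩ _
  have hsub : D'.localPolyhedron P z ⊆ {x | -w (Sum.inr ()) ≤ x ⬝ᵥ extend (w ∘ Sum.inl) 1} := by
    refine convexHull_min ?_ hC
    rintro _ ⟨m, c, rfl, hm, hc⟩
    have hle := hc.trans ((isLeast_eval_extend_one hm).2 ⟨w, hw, rfl⟩)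
    simp only [extend_dotProduct] at hle
    rw [Set.mem_ofPred_eq, castQ_extend, extend_dotProduct]
    simp only [extend, Sum.elim_comp_inl, Sum.elim_inr]
    linarith
  have hle := hsub h
  rw [Set.mem_ofPred_eq, extend_dotProduct] at hle
  rw [extend_dotProduct]
  simp only [extend, Sum.elim_comp_inl, Sum.elim_inr] at hle
  linarith

theorem castQ_extend_mem_localPolyhedron_iff (hP : Convex ℚ P) {m : ι → ℤ} {c : ℤ} :
    castQ (extend m c) ∈ D'.localPolyhedron P z ↔
      castQ m ∈ P ∧ -(c : ℚ) ≤ D'.eval (extend m 1) z := by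
  refine ⟨fun h => ?_, fun h => castQ_extend_mem_localPolyhedron h.1 h.2⟩
  have hm : castQ m ∈ P := comp_inl_mem_of_mem_localPolyhedron hP h
  obtain ⟨w, hw, hw'⟩ := (isLeast_eval_extend_one (D' := D') (z := z) hm).1
  rw [castQ_extend] at h
  exact ⟨hm, hw' ▸ neg_le_dotProduct_of_extend_mem_localPolyhedron h hw⟩

theorem isNormalPolyhedron_localPolyhedron_of_notMem_support (hP : Convex ℚ P)
    (hPN : IsNormalPolyhedron P) (hz : z ∉ D'.support) :
    IsNormalPolyhedron (D'.localPolyhedron P z) := by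
  have hz0 : (0 : ι ⊕ Unit → ℚ) ∈ D'.coeff z :=
    not_not.mp hz ▸ zero_mem (dualCone (reesCone σ P))
  refine isNormalPolyhedron_of_convex (convex_convexHull ℚ _) ?_
  rintro s hs x ⟨y, hy, hyx⟩
  obtain ⟨g, hg, hgx⟩ := (hPN s hs (x ∘ Sum.inl)).mp
    ⟨_, comp_inl_mem_of_mem_localPolyhedron hP hy, congrArg (· ∘ Sum.inl) hyx⟩
  have hx0 : 0 ≤ x (Sum.inr ()) := by
    rw [← extend_comp_inl y] at hy
    have hy0 : 0 ≤ y (Sum.inr ()) := by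
      simpa using neg_le_dotProduct_of_extend_mem_localPolyhedron hy hz0
    have h : (s : ℚ) * y (Sum.inr ()) = x (Sum.inr ()) := congrFun hyx (Sum.inr ())
    exact_mod_cast h ▸ mul_nonneg s.cast_nonneg hy0
  let j₀ : Fin s := ⟨0, hs⟩
  refine ⟨fun j => extend (g j) (Finsupp.single j₀ (x (Sum.inr ())) j), fun j =>
    castQ_extend_mem_localPolyhedron (hg j) ?_, ?_⟩
  · rw [eval_extend_one_of_notMem_support hz (hg j), neg_nonpos, Int.cast_nonneg_iff]
    exact Finsupp.single_nonneg.mpr hx0 j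
  · rw [sum_extend, hgx, Finsupp.univ_sum_single_apply, extend_comp_inl]

end ReesCone

variable [IsDedekindDomain R] {K : Type*} [Field K] [Algebra R K] [IsFractionRing R K]
  {σ : PointedCone ℚ (ι → ℚ)}

section Algebra

variable (D : PolyhedralDivisor R σ)

theorem single_mem_algebra_iff {m : ι → ℤ} {f : K} :
    AddMonoidAlgebra.single m f ∈ D.algebra K ↔ f ∈ D.piece K m := by
  classical
  refine ⟨fun h => by simpa using h m, fun h m' => ?_⟩
  rw [AddMonoidAlgebra.coeff_single, Finsupp.single_apply]
  split_ifs with h'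
  exacts [h' ▸ h, Submodule.zero_mem _]

instance gradedRing_algebra [DecidableEq (ι → ℤ)] : GradedRing (gradedPiece (D.algebra K)) :=
  gradedRingOfSingleCoeffMem fun _ hF m => D.single_mem_algebra_iff.mpr (hF m)

theorem IsHomogeneousIdeal.isHomogeneous [DecidableEq (ι → ℤ)] {I : Ideal (D.algebra K)}
    (hI : D.IsHomogeneousIdeal K I) : I.IsHomogeneous (gradedPiece (D.algebra K)) := by
  obtain ⟨-, S, hS, rfl⟩ := hI
  exact Ideal.homogeneous_span _ _ fun a ha =>
    have ⟨m, f, h⟩ := hS a ha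
    ⟨m, mem_gradedPiece.mpr ⟨f, h⟩⟩

theorem isRootClosed_algebra : IsRootClosed (D.algebra K) := by
  intro N m f hN h
  have hN0 : (0 : ℚ) < N := by exact_mod_cast hN
  rw [single_mem_algebra_iff] at h ⊢
  obtain rfl | hf := eq_or_ne f 0
  · exact Submodule.zero_mem _
  by_cases hNm : castQ (N • m) ∈ dualCone (σ : Set (ι → ℚ))
  swap
  · rw [piece, if_neg hNm, Submodule.mem_bot] at h
    exact absurd (eq_zero_of_pow_eq_zero h) hf
  have hm : castQ m ∈ dualCone (σ : Set (ι → ℚ)) := by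
    rw [mem_dualCone] at hNm ⊢
    simpa only [castQ_nsmul, smul_dotProduct, smul_eq_mul, mul_nonneg_iff_of_pos_left hN0] using hNm
  rw [piece, if_pos hNm] at h
  rw [piece, if_pos hm]
  intro z
  obtain ⟨c, hc⟩ := exists_valuation_eq_exp z hf
  have hz := h z
  rw [map_pow, hc, ← WithZero.exp_nsmul, WithZero.exp_le_exp, D.eval_nsmul hm, Int.le_floor,
    nsmul_eq_mul, Int.cast_mul, Int.cast_natCast] at hz
  rw [hc, WithZero.exp_le_exp, Int.le_floor]
  exact le_of_mul_le_mul_left hz hN0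

end Algebra

section AssociatedPair

variable {D : PolyhedralDivisor R σ} {I : Ideal (D.algebra K)} {P : Set (ι → ℚ)}
  {D' : PolyhedralDivisor R (dualCone (reesCone σ P))}

namespace IsAssociatedPair

theorem mem_orders_iff (h : D.IsAssociatedPair K I P D') {x : (ι → ℤ) × ℤ} :
    x ∈ orders z I ↔ castQ x.1 ∈ P ∧ -(x.2 : ℚ) ≤ D'.eval (extend x.1 1) z := by
  classical
  obtain ⟨m, c⟩ := x
  constructor
  · rintro ⟨F, hF, hle⟩
    have hne : (F : AddMonoidAlgebra K (ι → ℤ)).coeff m ≠ 0 :=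
      (Valuation.ne_zero_iff _).mp (WithZero.exp_pos.trans_le hle).ne'
    obtain ⟨hm, hs⟩ := h.ideal_eq.subset ⟨F, hF, rfl⟩ m hne
    have hc := hle.trans (hs z)
    rw [WithZero.exp_le_exp, Int.le_floor] at hc
    exact ⟨hm, by simpa using hc⟩
  · rintro ⟨hm, hc⟩
    have hfin : {y | D'.eval (extend m 1) y ≠ 0}.Finite :=
      D'.finite_support.subset fun y hy =>
        not_imp_comm.mp (eval_extend_one_of_notMem_support · hm) hy
    obtain ⟨g, hg, hgz⟩ := exists_mem_globalSections_valuation_eq (K := K) hfin z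
    obtain ⟨F, hF, hFg⟩ : AddMonoidAlgebra.single m g ∈
        ((↑) : D.algebra K → AddMonoidAlgebra K (ι → ℤ)) '' (I : Set (D.algebra K)) := by
      rw [h.ideal_eq]
      intro m' hm'
      obtain rfl | hne := eq_or_ne m' m
      · exact ⟨hm, by simpa using hg⟩
      · exact absurd (by simp [hne]) hm'
    refine ⟨F, hF, ?_⟩
    dsimp only at hFg hc ⊢
    rw [hFg, AddMonoidAlgebra.coeff_single, Finsupp.single_eq_same, hgz, WithZero.exp_le_exp,
      Int.le_floor]
    simpa using hc

theorem isNormalPolyhedron_localPolyhedron (h : D.IsAssociatedPair K I P D')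
    (hsupp : ∀ z ∈ D'.support, IsNormalPolyhedron (D'.localPolyhedron P z))
    (hempty : D'.support = ∅ → IsNormalPolyhedron P) (z : HeightOneSpectrum R) :
    IsNormalPolyhedron (D'.localPolyhedron P z) := by
  by_cases hz : z ∈ D'.support
  · exact hsupp z hz
  refine isNormalPolyhedron_localPolyhedron_of_notMem_support h.polyhedron.convex ?_ hz
  obtain h0 | ⟨z₀, hz₀⟩ := D'.support.eq_empty_or_nonempty
  · exact hempty h0
  · exact isNormalPolyhedron_of_localPolyhedron h.polyhedron.convex
      (h.polyhedron.subset_convexHull_castQ fun _ ⟨_, m, hm⟩ => ⟨m, hm.symm⟩) (hsupp z₀ hz₀)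

theorem isNormalIdeal (hR : ¬ IsField R) (h : D.IsAssociatedPair K I P D')
    (hI : D.IsHomogeneousIdeal K I)
    (hD' : ∀ z, IsNormalPolyhedron (D'.localPolyhedron P z)) : IsNormalIdeal I := by
  classical
  have hI := hI.isHomogeneous
  refine isNormalIdeal_of_saturation_reesMonoid hR hI fun z s hs x hx => ?_
  have hmem (y : (ι → ℤ) × ℤ) :
      y ∈ orders z I ↔ castQ (extend y.1 y.2) ∈ D'.localPolyhedron P z := by
    rw [h.mem_orders_iff, castQ_extend_mem_localPolyhedron_iff h.polyhedron.convex]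
  obtain ⟨N, hN, hx⟩ := (mk_mem_saturation_reesMonoid_iff hI).mp hx
  obtain ⟨f, hf, hfx⟩ := exists_sum_eq_of_mem_orders_pow (Nat.mul_pos hN hs) hx
  have hsx : castQ (extend x.1 x.2) ∈ (s : ℚ) • D'.localPolyhedron P z := by
    refine castQ_mem_smul_of_sum_eq_nsmul (convex_convexHull ℚ _) hN hs
      (fun j => (hmem _).mp (hf j)) ?_
    rw [sum_extend, ← Prod.fst_sum, ← Prod.snd_sum, hfx]
    ext (i | i) <;> simp [extend]
  obtain ⟨g, hg, hgx⟩ := (hD' z s hs _).mp hsx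
  have hxg : x = ∑ j, (g j ∘ Sum.inl, g j (Sum.inr ())) := by
    refine Prod.ext ?_ ?_
    · rw [Prod.fst_sum, ← sum_comp_inl, hgx]
      rfl
    · rw [Prod.snd_sum, ← Finset.sum_apply, hgx]
      rfl
  rw [hxg]
  exact sum_mem_orders_pow hI fun j => (hmem _).mpr (by simpa only [extend_comp_inl] using hg j)

end IsAssociatedPair

end AssociatedPair

theorem IsHomogeneousIdeal.isNormalIdeal_idealClosure_pow {D : PolyhedralDivisor R σ}
    {I : Ideal (D.algebra K)} (hR : ¬ IsField R) (hI : D.IsHomogeneousIdeal K I) {e : ℕ}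
    (he : Fintype.card ι ≤ e) : IsNormalIdeal (idealClosure (I ^ e)) := by
  classical
  exact ComplexityOne.isNormalIdeal_idealClosure_pow hR D.isRootClosed_algebra hI.isHomogeneous
    (by simpa using he)

end PolyhedralDivisor

/-! ### Actions of the multiplicative group on surfaces -/

section Dimension

universe u v

theorem ringKrullDim_le_of_isIntegral {S T : Type*} [CommRing S] [CommRing T] [Algebra S T]
    [Algebra.IsIntegral S T] (hinj : Function.Injective (algebraMap S T)) :
    ringKrullDim S ≤ ringKrullDim T := by
  refine iSup_le fun l => ?_
  obtain ⟨P, -, hP, hPl⟩ := Ideal.exists_ideal_over_prime_of_isIntegral l.head.asIdeal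
    (⊥ : Ideal T) (by
      rw [← RingHom.ker_eq_comap_bot, (RingHom.injective_iff_ker_eq_bot _).mp hinj]
      exact bot_le)
  have : P.LiesOver l.head.asIdeal := ⟨hPl.symm⟩
  obtain ⟨L, hL, -⟩ := Ideal.exists_ltSeries_of_hasGoingUp l P
  rw [← hL]
  exact le_iSup (fun p : LTSeries (PrimeSpectrum T) => (p.length : WithBot ℕ∞)) L

theorem trdeg_le_of_ringKrullDim_eq {k : Type u} {B : Type v} [Field k] [CommRing B] [IsDomain B]
    [Algebra k B] [Algebra.FiniteType k B] {n : ℕ} (h : ringKrullDim B = n) :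
    Algebra.trdeg k B ≤ n := by
  obtain ⟨s, g, hinj, hint⟩ := exists_integral_inj_algHom_of_fg k B
  algebraize [g.toRingHom]
  have : Algebra.IsIntegral (MvPolynomial (Fin s) k) B := ⟨hint⟩
  have hsn := ringKrullDim_le_of_isIntegral (S := MvPolynomial (Fin s) k) (T := B) hinj
  rw [MvPolynomial.ringKrullDim_of_isNoetherianRing, ringKrullDim_eq_zero_of_field, zero_add, h,
    Nat.card_eq_fintype_card, Fintype.card_fin] at hsn
  have : FaithfulSMul (MvPolynomial (Fin s) k) B :=
    (faithfulSMul_iff_algebraMap_injective _ _).mpr hinj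
  have : IsScalarTower k (MvPolynomial (Fin s) k) B :=
    IsScalarTower.of_algebraMap_eq fun x => (g.commutes x).symm
  have htrdeg := lift_trdeg_add_eq k (MvPolynomial (Fin s) k) B
  rw [MvPolynomial.trdeg_of_isDomain, trdeg_eq_zero, Cardinal.lift_zero, add_zero] at htrdeg
  rw [← Cardinal.lift_le.{u}, ← htrdeg]
  simpa using (show s ≤ n by exact_mod_cast hsn)

variable {k : Type u} [Field k] {S : Type v} [CommRing S] [IsDomain S] [Algebra k S]

theorem exists_aeval_mem_of_trdeg_le_one (h : Algebra.trdeg k S ≤ 1) {p : Ideal S} (hp : p ≠ ⊥)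
    (r : S) : ∃ g : Polynomial k, g ≠ 0 ∧ Polynomial.aeval r g ∈ p := by
  obtain ⟨q, hq, hq0⟩ := Submodule.exists_mem_ne_zero_of_ne_bot hp
  by_cases hr : IsAlgebraic k r
  · obtain ⟨g, hg0, hg⟩ := hr
    exact ⟨g, hg0, hg ▸ p.zero_mem⟩
  have hi : AlgebraicIndependent k (fun _ : Unit => r) :=
    algebraicIndependent_unique_type_iff.mpr hr
  have := (hi.isTranscendenceBasis_of_lift_trdeg_le_of_finite (by simpa using h)).isAlgebraic
  have halg : IsAlgebraic (Algebra.adjoin k (Set.range fun _ : Unit => r)) q :=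
    Algebra.IsAlgebraic.isAlgebraic q
  obtain ⟨⟨y, hy⟩, hy0, hqy⟩ := halg.exists_nonzero_dvd (mem_nonZeroDivisors_of_ne_zero hq0)
  rw [Set.range_const, Algebra.adjoin_singleton_eq_range_aeval] at hy
  obtain ⟨g, rfl⟩ := hy
  refine ⟨g, ?_, p.mem_of_dvd hqy hq⟩
  rintro rfl
  exact hy0 (Subtype.ext (map_zero _))

theorem exists_sub_algebraMap_mem_of_trdeg_le_one [IsAlgClosed k] (h : Algebra.trdeg k S ≤ 1)
    {p : Ideal S} [hp : p.IsPrime] (hp0 : p ≠ ⊥) (r : S) : ∃ a : k, r - algebraMap k S a ∈ p := by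
  obtain ⟨g, hg0, hg⟩ := exists_aeval_mem_of_trdeg_le_one h hp0 r
  rw [(IsAlgClosed.splits g).eq_prod_roots, map_mul, Polynomial.aeval_C, map_multiset_prod,
    Multiset.map_map] at hg
  have hunit : IsUnit (algebraMap k S g.leadingCoeff) :=
    (IsUnit.mk0 _ (Polynomial.leadingCoeff_ne_zero.mpr hg0)).map _
  have hg := (hp.mem_or_mem hg).resolve_left fun h => hp.ne_top (p.eq_top_of_isUnit_mem h hunit)
  obtain ⟨y, hy, hyp⟩ := (hp.multiset_prod_mem_iff_exists_mem _).mp hg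
  obtain ⟨a, -, rfl⟩ := Multiset.mem_map.mp hy
  exact ⟨a, by simpa using hyp⟩

theorem dimensionLEOne_of_trdeg_le_one [IsAlgClosed k] (h : Algebra.trdeg k S ≤ 1) :
    Ring.DimensionLEOne S where
  maximalOfPrime {p} hp0 hp := by
    have hsurj : Function.Surjective (algebraMap k (S ⧸ p)) := by
      rintro ⟨r⟩
      obtain ⟨a, ha⟩ := exists_sub_algebraMap_mem_of_trdeg_le_one h hp0 r
      exact ⟨a, (Ideal.Quotient.eq.mpr ha).symm⟩
    exact Ideal.Quotient.maximal_of_isField p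
      (RingEquiv.ofBijective (algebraMap k (S ⧸ p)) ⟨(algebraMap k (S ⧸ p)).injective, hsurj⟩
        |>.symm.toMulEquiv.isField (Field.toIsField k))

end Dimension

section Retraction

/-- The retraction `π` exhibits every ideal `J` of `R` as `JS ∩ R`. -/
theorem isNoetherianRing_of_retraction {R S : Type*} [CommRing R] [CommRing S] [Algebra R S]
    [IsNoetherianRing S] (π : S →ₗ[R] R) (hπ : π 1 = 1) : IsNoetherianRing R := by
  have hmem (J : Ideal R) {r : R} (hr : algebraMap R S r ∈ J.map (algebraMap R S)) : r ∈ J := by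
    have hr : r • (1 : S) ∈ J • (⊤ : Submodule R S) := by
      rw [Ideal.smul_top_eq_map, ← Algebra.algebraMap_eq_smul_one]
      exact hr
    have := Submodule.mem_map_of_mem (f := π) hr
    rw [Submodule.map_smul'', map_smul, hπ, smul_eq_mul r, mul_one] at this
    exact Ideal.mul_le_left this
  have hcomap (J : Ideal R) : (J.map (algebraMap R S)).comap (algebraMap R S) = J :=
    le_antisymm (fun _ => hmem J) Ideal.le_comap_map
  have hmono : StrictMono (Ideal.map (algebraMap R S)) :=
    Monotone.strictMono_of_injective (fun _ _ => Ideal.map_mono)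
      (Function.LeftInverse.injective hcomap)
  exact isNoetherian_iff'.mpr hmono.wellFoundedGT

end Retraction

section Weights

variable {k : Type*} [Field k]

theorem eq_zero_of_forall_units_zpow_eq_one [Infinite k] {m : ℤ} (h : ∀ t : kˣ, t ^ m = 1) :
    m = 0 := by
  have hpow (t : kˣ) : (t : k) ^ m.natAbs = 1 := by
    rw [← Units.val_pow_eq_pow_val, Units.val_eq_one]
    exact pow_natAbs_eq_one.mpr (h t)
  have hpoly : (Polynomial.X ^ (m.natAbs + 1) : Polynomial k) = Polynomial.X ^ 1 := by
    refine Polynomial.funext fun a => ?_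
    rw [Polynomial.eval_pow, Polynomial.eval_pow, Polynomial.eval_X, pow_one, pow_succ]
    rcases eq_or_ne a 0 with rfl | ha
    · exact mul_zero _
    · rw [show a ^ m.natAbs = 1 from hpow (Units.mk0 a ha), one_mul]
  have hdeg := congrArg Polynomial.natDegree hpoly
  rw [Polynomial.natDegree_X_pow, Polynomial.natDegree_X_pow] at hdeg
  omega

variable (k) in
/-- The character `t ↦ t ^ m` of `kˣ`. -/
def zpowChar (m : ℤ) : kˣ →* k := (Units.coeHom k).comp (zpowGroupHom m)

theorem zpowChar_injective [Infinite k] : Function.Injective (zpowChar k) := fun m m' h => by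
  refine sub_eq_zero.mp (eq_zero_of_forall_units_zpow_eq_one (k := k) fun t => ?_)
  rw [zpow_sub, mul_inv_eq_one]
  exact Units.ext (DFunLike.congr_fun h t)

theorem eq_zero_of_forall_sum_zpow_smul_eq_zero [Infinite k] {V α : Type*} [AddCommGroup V]
    [Module k V] {w : α → ℤ} (hw : Function.Injective w) {s : Finset α} {x : α → V}
    (h : ∀ t : kˣ, ∑ i ∈ s, ((t ^ w i : kˣ) : k) • x i = 0) : ∀ i ∈ s, x i = 0 := by
  have hli := (linearIndependent_monoidHom kˣ k).comp _ (zpowChar_injective.comp hw)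
  intro i hi
  refine (Module.forall_dual_apply_eq_zero_iff k (x i)).mp fun φ => ?_
  refine linearIndependent_iff'.mp hli s (fun i => φ (x i)) (funext fun t => ?_) i hi
  rw [Finset.sum_apply, Pi.zero_apply, ← map_zero φ, ← h t, map_sum]
  exact Finset.sum_congr rfl fun j _ => by
    rw [map_smul, Pi.smul_apply, smul_eq_mul, smul_eq_mul, mul_comm]
    rfl

variable {C : Type*} [CommRing C] [Algebra k C] {ρ : kˣ →* (C ≃ₐ[k] C)}

instance gradedMonoid_weightSpace : SetLike.GradedMonoid (weightSpace ρ) where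
  one_mem t := by rw [map_one, zpow_zero, Units.val_one, one_smul]
  mul_mem m m' x y hx hy t := by
    rw [map_mul, hx t, hy t, smul_mul_smul_comm, zpow_add, Units.val_mul]

theorem mem_of_sum_mem_of_stable [Infinite k] {J : Ideal C} (hJ : ∀ t : kˣ, ∀ b ∈ J, ρ t b ∈ J)
    {α : Type*} {w : α → ℤ} (hw : Function.Injective w) {s : Finset α} {c : α → C}
    (hc : ∀ i ∈ s, c i ∈ weightSpace ρ (w i)) (hsum : ∑ i ∈ s, c i ∈ J) : ∀ i ∈ s, c i ∈ J := by
  have hquot (t : kˣ) :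
      ∑ i ∈ s, ((t ^ w i : kˣ) : k) • Ideal.Quotient.mkₐ k J (c i) = 0 := by
    have ht : Ideal.Quotient.mkₐ k J (ρ t (∑ i ∈ s, c i)) = 0 :=
      Ideal.Quotient.eq_zero_iff_mem.mpr (hJ t _ hsum)
    rw [← ht, map_sum, map_sum]
    exact Finset.sum_congr rfl fun i hi => by rw [← map_smul, ← hc i hi t]
  exact fun i hi => Ideal.Quotient.eq_zero_iff_mem.mp
    (eq_zero_of_forall_sum_zpow_smul_eq_zero hw hquot i hi)

theorem eq_zero_of_sum_weightSpace_eq_zero [Infinite k] {α : Type*} {w : α → ℤ}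
    (hw : Function.Injective w) {s : Finset α} {c : α → C}
    (hc : ∀ i ∈ s, c i ∈ weightSpace ρ (w i)) (hsum : ∑ i ∈ s, c i = 0) : ∀ i ∈ s, c i = 0 :=
  mem_of_sum_mem_of_stable (J := ⊥)
    (fun t b hb => by rw [Ideal.mem_bot.mp hb, map_zero]; exact zero_mem _) hw hc hsum

theorem iSup_weightSpace [Infinite k] (hρ : IsAlgebraicAction ρ) : ⨆ m, weightSpace ρ m = ⊤ := by
  refine eq_top_iff.mpr fun b _ => ?_
  obtain ⟨c, hc⟩ := hρ b
  have hb : b = ∑ m ∈ c.support, c m := by simpa [Finsupp.sum] using hc 1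
  rw [hb]
  refine sum_mem fun m hm => Submodule.mem_iSup_of_mem m fun s => ?_
  -- compare the coefficients of `t ^ m` in `ρ (s * t) b = ρ s (ρ t b)`
  refine sub_eq_zero.mp (eq_zero_of_forall_sum_zpow_smul_eq_zero (k := k) Function.injective_id
    (x := fun m => ρ s (c m) - ((s ^ m : kˣ) : k) • c m) (fun t => ?_) m hm)
  have h : ρ s (ρ t b) - ρ (s * t) b = 0 := by rw [map_mul, sub_eq_zero]; rfl
  rw [hc, hc, Finsupp.sum, Finsupp.sum, map_sum, ← Finset.sum_sub_distrib] at h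
  rw [← h]
  refine Finset.sum_congr rfl fun i _ => ?_
  rw [id, map_smul, smul_sub, smul_smul, mul_zpow, mul_comm (s ^ i), Units.val_mul]

theorem eq_one_of_forall_mem_weightSpace_eq_zero [Infinite k] (hρ : IsAlgebraicAction ρ)
    (h : ∀ m, ∀ b ∈ weightSpace ρ m, b ≠ 0 → m = 0) : ρ = 1 := by
  have htop : weightSpace ρ 0 = ⊤ := by
    rw [eq_top_iff, ← iSup_weightSpace hρ]
    refine iSup_le fun m b hb => ?_
    rcases eq_or_ne b 0 with rfl | hb0
    · exact zero_mem _
    · exact h m b hb hb0 ▸ hb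
  ext t b
  rw [(htop ▸ Submodule.mem_top : b ∈ weightSpace ρ 0) t, zpow_zero, Units.val_one, one_smul]
  rfl

/-- The grading of the coordinate ring by the weights of an algebraic action. -/
abbrev gradedRingWeightSpace [Infinite k] (hρ : IsAlgebraicAction ρ) :
    GradedRing (weightSpace ρ) where
  __ := ((DirectSum.isInternal_submodule_iff_iSupIndep_and_iSup_eq_top _).mpr
    ⟨(iSupIndep_iff_finsetSum_eq_zero_imp_eq_zero _).mpr fun _ _ hx h =>
      eq_zero_of_sum_weightSpace_eq_zero Function.injective_id hx h,
      iSup_weightSpace hρ⟩).chooseDecomposition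

end Weights

section Invariants

variable {k : Type*} [Field k]

/-- The ring of invariants of an action of `kˣ`. -/
def invariants {B : Type*} [CommRing B] [Algebra k B] (ρ : kˣ →* (B ≃ₐ[k] B)) : Subalgebra k B :=
  SetLike.GradeZero.subalgebra (weightSpace ρ)

section Field

variable {L : Type*} [Field L] [Algebra k L] {τ : kˣ →* (L ≃ₐ[k] L)}

theorem inv_mem_weightSpace {m : ℤ} {x : L} (hx : x ∈ weightSpace τ m) :
    x⁻¹ ∈ weightSpace τ (-m) := fun t => by
  rw [map_inv₀, hx t, Algebra.smul_def, Algebra.smul_def, mul_inv, ← map_inv₀, zpow_neg,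
    Units.val_inv_eq_inv_val]

theorem zpow_mem_weightSpace {d : ℤ} {x : L} (hx : x ∈ weightSpace τ d) (m : ℤ) :
    x ^ m ∈ weightSpace τ (m * d) := fun t => by
  rw [map_zpow₀, hx t, Algebra.smul_def, Algebra.smul_def, mul_zpow, ← map_zpow₀, mul_comm m,
    zpow_mul, Units.val_zpow_eq_zpow_val (t ^ d)]

variable (τ) in
/-- The field of invariants of an action of `kˣ` on a field. -/
def invariantField : IntermediateField k L where
  __ := invariants τ
  inv_mem' _ hx := by
    have := inv_mem_weightSpace (τ := τ) (m := 0) hx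
    rwa [neg_zero] at this

variable (τ) in
/-- The group of weights of the nonzero weight vectors of a field. -/
def weightSubgroup : AddSubgroup ℤ where
  carrier := {m | ∃ x ∈ weightSpace τ m, x ≠ 0}
  zero_mem' := ⟨1, SetLike.GradedOne.one_mem, one_ne_zero⟩
  add_mem' := by
    rintro m m' ⟨x, hx, hx0⟩ ⟨y, hy, hy0⟩
    exact ⟨x * y, SetLike.GradedMul.mul_mem hx hy, mul_ne_zero hx0 hy0⟩
  neg_mem' := by
    rintro m ⟨x, hx, hx0⟩
    exact ⟨x⁻¹, inv_mem_weightSpace hx, inv_ne_zero hx0⟩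

variable (τ) in
theorem exists_mem_weightSpace_forall_dvd :
    ∃ (d : ℤ) (x : Lˣ), (x : L) ∈ weightSpace τ d ∧
      ∀ m, ∀ y ∈ weightSpace τ m, y ≠ 0 → d ∣ m := by
  obtain ⟨d, hd⟩ := Int.subgroup_cyclic (weightSubgroup τ)
  have mem_iff (m : ℤ) : m ∈ weightSubgroup τ ↔ d ∣ m := by
    rw [hd, ← AddSubgroup.zmultiples_eq_closure, Int.mem_zmultiples_iff]
  obtain ⟨x, hx, hx0⟩ := (mem_iff d).mpr dvd_rfl
  exact ⟨d, Units.mk0 x hx0, hx, fun m y hy hy0 => (mem_iff m).mp ⟨y, hy, hy0⟩⟩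

variable (τ) in
/-- The evaluation of Laurent polynomials over the field of invariants at a unit `x`; for a weight
vector `x` of nonzero weight it identifies them with a subring of `L`. -/
def laurentEval (x : Lˣ) : AddMonoidAlgebra (invariantField τ) ℤ →ₐ[invariantField τ] L :=
  AddMonoidAlgebra.lift _ _ _ ((Units.coeHom L).comp (zpowersHom Lˣ x))

theorem laurentEval_single (x : Lˣ) (m : ℤ) (f : invariantField τ) :
    laurentEval τ x (.single m f) = f * (x : L) ^ m := by
  rw [laurentEval, AddMonoidAlgebra.lift_single, Algebra.smul_def]
  exact congrArg (_ * ·) (Units.val_zpow_eq_zpow_val x m)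

theorem laurentEval_single_mem_weightSpace {x : Lˣ} {d : ℤ} (hx : (x : L) ∈ weightSpace τ d)
    (m : ℤ) (f : invariantField τ) : laurentEval τ x (.single m f) ∈ weightSpace τ (m * d) := by
  rw [laurentEval_single, ← zero_add (m * d)]
  exact SetLike.GradedMul.mul_mem f.2 (zpow_mem_weightSpace hx m)

theorem laurentEval_injective [Infinite k] {x : Lˣ} {d : ℤ} (hd : d ≠ 0)
    (hx : (x : L) ∈ weightSpace τ d) : Function.Injective (laurentEval τ x) := by
  refine (injective_iff_map_eq_zero _).mpr fun F hF => ?_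
  have hsum : ∑ m ∈ F.coeff.support, laurentEval τ x (.single m (F.coeff m)) = 0 := by
    rw [← map_sum, ← hF]
    exact congrArg _ (AddMonoidAlgebra.sum_coeff_single F)
  ext m
  by_contra hm
  have h := eq_zero_of_sum_weightSpace_eq_zero (mul_left_injective₀ hd)
    (fun m _ => laurentEval_single_mem_weightSpace hx m _) hsum m
    (Finsupp.mem_support_iff.mpr fun h0 => hm (congrArg Subtype.val h0))
  rw [laurentEval_single] at h
  exact hm ((mul_eq_zero.mp h).resolve_right (zpow_ne_zero m x.ne_zero))

theorem transcendental_of_mem_weightSpace [Infinite k] {x : Lˣ} {d : ℤ} (hd : d ≠ 0)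
    (hx : (x : L) ∈ weightSpace τ d) : Transcendental (invariantField τ) (x : L) := by
  have h : Polynomial.aeval (x : L) = (laurentEval τ x).comp Polynomial.toLaurentAlg := by
    refine Polynomial.algHom_ext ?_
    rw [Polynomial.aeval_X, AlgHom.comp_apply, Polynomial.toLaurentAlg_apply,
      Polynomial.toLaurent_X]
    exact (laurentEval_single x 1 1).trans (by simp) |>.symm
  rw [transcendental_iff_injective, h]
  exact (laurentEval_injective hd hx).comp Polynomial.toLaurent_injective

end Field

section Fractions

variable {B L : Type*} [CommRing B] [Algebra k B] [Field L] [Algebra B L]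
  [IsFractionRing B L] [Algebra k L] [IsScalarTower k B L]

variable (L) in
/-- The induced action on the field of fractions. -/
def fractionAction (ρ : kˣ →* (B ≃ₐ[k] B)) : kˣ →* (L ≃ₐ[k] L) :=
  (IsFractionRing.fieldEquivOfAlgEquivHom k L).comp ρ

theorem fractionAction_algebraMap (ρ : kˣ →* (B ≃ₐ[k] B)) (t : kˣ) (b : B) :
    fractionAction L ρ t (algebraMap B L b) = algebraMap B L (ρ t b) :=
  IsFractionRing.fieldEquivOfAlgEquiv_algebraMap k L L (ρ t) b

theorem algebraMap_mem_weightSpace_iff {ρ : kˣ →* (B ≃ₐ[k] B)} {m : ℤ} {b : B} :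
    algebraMap B L b ∈ weightSpace (fractionAction L ρ) m ↔ b ∈ weightSpace ρ m := by
  refine forall_congr' fun t => ?_
  rw [fractionAction_algebraMap, ← IsScalarTower.coe_toAlgHom' k B L, ← map_smul]
  exact (IsFractionRing.injective B L).eq_iff

variable (ρ : kˣ →* (B ≃ₐ[k] B))

instance : Algebra (invariants ρ) (invariantField (fractionAction L ρ)) :=
  RingHom.toAlgebra <| ((algebraMap B L).comp (invariants ρ).val.toRingHom).codRestrict
    (invariantField (fractionAction L ρ)).toSubring fun b => algebraMap_mem_weightSpace_iff.mpr b.2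

instance : IsScalarTower (invariants ρ) (invariantField (fractionAction L ρ)) L :=
  IsScalarTower.of_algebraMap_eq fun _ => rfl

instance : IsScalarTower k (invariants ρ) (invariantField (fractionAction L ρ)) :=
  IsScalarTower.of_algebraMap_eq fun x => Subtype.ext (IsScalarTower.algebraMap_apply k B L x)

instance : FaithfulSMul (invariants ρ) (invariantField (fractionAction L ρ)) :=
  (faithfulSMul_iff_algebraMap_injective _ _).mpr fun _ _ h =>
    Subtype.ext (IsFractionRing.injective B L (congrArg Subtype.val h))

variable {ρ}

theorem exists_algebraMap_invariants_eq_of_isIntegral [IsIntegrallyClosed B]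
    {x : invariantField (fractionAction L ρ)} (hx : IsIntegral (invariants ρ) x) :
    ∃ y, algebraMap (invariants ρ) (invariantField (fractionAction L ρ)) y = x := by
  have hxL : IsIntegral (invariants ρ) (x : L) := hx.algebraMap
  obtain ⟨b, hb⟩ := IsIntegrallyClosed.isIntegral_iff.mp (hxL.tower_top (A := B))
  exact ⟨⟨b, algebraMap_mem_weightSpace_iff.mp (hb ▸ x.2)⟩, Subtype.ext hb⟩

end Fractions

end Invariants

section InvariantCurve

universe u v

variable {k : Type u} [Field k]

theorem trdeg_invariantField_add_one_le [Infinite k] {L : Type v} [Field L] [Algebra k L]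
    {τ : kˣ →* (L ≃ₐ[k] L)} {x : Lˣ} {d : ℤ} (hd : d ≠ 0) (hx : (x : L) ∈ weightSpace τ d) :
    Algebra.trdeg k (invariantField τ) + 1 ≤ Algebra.trdeg k L := by
  have : Algebra.Transcendental (invariantField τ) L :=
    ⟨x, transcendental_of_mem_weightSpace hd hx⟩
  rw [← trdeg_add_eq k (invariantField τ) (A := L)]
  exact add_le_add_right (Cardinal.one_le_iff_pos.mpr (trdeg_pos (invariantField τ) L)) _

theorem isAlgebraic_of_trdeg_le_one {S T : Type v} [CommRing S] [CommRing T] [IsDomain T]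
    [Algebra k S] [Algebra k T] [Algebra S T] [IsScalarTower k S T] [FaithfulSMul S T]
    (h : Algebra.trdeg k T ≤ 1) {r : S} (hr : Transcendental k r) : Algebra.IsAlgebraic S T := by
  have := (FaithfulSMul.algebraMap_injective S T).isDomain
  have : Algebra.Transcendental k S := ⟨r, hr⟩
  have hS : 1 ≤ Algebra.trdeg k S := Cardinal.one_le_iff_pos.mpr (trdeg_pos _ _)
  rw [← trdeg_add_eq k S] at h
  have hST : Algebra.trdeg S T + 1 ≤ 0 + 1 := by
    rw [zero_add, add_comm]
    exact (add_le_add_left hS _).trans h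
  rw [← trdeg_eq_zero_iff]
  exact le_zero_iff.mp ((Cardinal.add_le_add_iff_of_lt_aleph0 Cardinal.one_lt_aleph0).mp hST)

variable {B : Type v} [CommRing B] [Algebra k B] {ρ : kˣ →* (B ≃ₐ[k] B)}

theorem exists_transcendental_of_not_isElliptic [IsDomain B] [IsAlgClosed k]
    (hell : ¬ IsElliptic ρ) : ∃ r : invariants ρ, Transcendental k r := by
  by_contra! h
  refine hell (le_antisymm (fun b hb => ?_) (Submodule.one_le.mpr (invariants ρ).one_mem))
  have : Algebra.IsAlgebraic k (invariants ρ) := ⟨fun r => not_not.mp (h r)⟩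
  obtain ⟨a, ha⟩ := (IsAlgClosed.algebraMap_bijective_of_isIntegral (k := k)
    (K := invariants ρ)).2 ⟨b, hb⟩
  exact Submodule.mem_one.mpr ⟨a, congrArg Subtype.val ha⟩

theorem not_isField_invariants [IsAlgClosed k] [IsDomain B] [Algebra.FiniteType k B]
    (hell : ¬ IsElliptic ρ) : ¬ IsField (invariants ρ) := by
  intro hf
  obtain ⟨r, hr⟩ := exists_transcendental_of_not_isElliptic hell
  obtain ⟨m, hm⟩ := Ideal.exists_maximal B
  let := Ideal.Quotient.field m
  have : Module.Finite k (B ⧸ m) := finite_of_finite_type_of_isJacobsonRing k (B ⧸ m)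
  let f : invariants ρ →ₐ[k] B ⧸ m := (Ideal.Quotient.mkₐ k m).comp (invariants ρ).val
  let := hf.toField
  exact hr ((isAlgebraic_algHom_iff f f.toRingHom.injective).mp
    (Algebra.IsAlgebraic.isAlgebraic (f r)))

/-- The Reynolds operator, which projects onto the component of weight zero. -/
def reynolds [GradedRing (weightSpace ρ)] : B →ₗ[invariants ρ] invariants ρ where
  toFun b := DirectSum.decompose (weightSpace ρ) b 0
  map_add' b c := by rw [DirectSum.decompose_add]; rfl
  map_smul' a b := Subtype.ext <| DirectSum.coe_decompose_mul_of_left_mem_zero (weightSpace ρ) a.2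

theorem isNoetherianRing_invariants [Infinite k] [IsNoetherianRing B] (hρ : IsAlgebraicAction ρ) :
    IsNoetherianRing (invariants ρ) := by
  let := gradedRingWeightSpace hρ
  refine isNoetherianRing_of_retraction (S := B) reynolds (Subtype.ext ?_)
  exact DirectSum.decompose_of_mem_same (weightSpace ρ) SetLike.GradedOne.one_mem

variable [IsDomain B] [IsAlgClosed k] [Algebra.FiniteType k B]
  {L : Type v} [Field L] [Algebra B L] [IsFractionRing B L] [Algebra k L] [IsScalarTower k B L]
  {x : Lˣ} {d : ℤ}

theorem trdeg_invariantField_le_one (hdim : ringKrullDim B = 2) (hd : d ≠ 0)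
    (hx : (x : L) ∈ weightSpace (fractionAction L ρ) d) :
    Algebra.trdeg k (invariantField (fractionAction L ρ)) ≤ 1 := by
  have hL : Algebra.trdeg k L ≤ 1 + 1 := by
    have : Algebra.IsAlgebraic B L := IsLocalization.isAlgebraic L (nonZeroDivisors B)
    rw [← trdeg_add_eq k B, trdeg_eq_zero (R := B), add_zero, one_add_one_eq_two]
    exact_mod_cast trdeg_le_of_ringKrullDim_eq (n := 2) hdim
  have : Infinite k := IsAlgClosed.instInfinite
  exact (Cardinal.add_le_add_iff_of_lt_aleph0 Cardinal.one_lt_aleph0).mp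
    ((trdeg_invariantField_add_one_le hd hx).trans hL)

variable [IsIntegrallyClosed B]

theorem isFractionRing_invariants (hdim : ringKrullDim B = 2) (hell : ¬ IsElliptic ρ) (hd : d ≠ 0)
    (hx : (x : L) ∈ weightSpace (fractionAction L ρ) d) :
    IsFractionRing (invariants ρ) (invariantField (fractionAction L ρ)) := by
  obtain ⟨r, hr⟩ := exists_transcendental_of_not_isElliptic hell
  have := isAlgebraic_of_trdeg_le_one (T := invariantField (fractionAction L ρ))
    (trdeg_invariantField_le_one hdim hd hx) hr
  have hinj := FaithfulSMul.algebraMap_injective (invariants ρ)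
    (invariantField (fractionAction L ρ))
  have : IsIntegralClosure (invariants ρ) (invariants ρ) (invariantField (fractionAction L ρ)) :=
    ⟨hinj, ⟨fun h => exists_algebraMap_invariants_eq_of_isIntegral h, by
      rintro ⟨y, rfl⟩
      exact isIntegral_algebraMap⟩⟩
  exact IsIntegralClosure.isFractionRing_of_algebraic (invariants ρ) (invariants ρ)
    fun y hy => hinj (by rw [hy, map_zero])

theorem isDedekindDomain_invariants (hdim : ringKrullDim B = 2) (hρ : IsAlgebraicAction ρ)
    (hell : ¬ IsElliptic ρ) (hd : d ≠ 0)
    (hx : (x : L) ∈ weightSpace (fractionAction L ρ) d) : IsDedekindDomain (invariants ρ) := by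
  have := isFractionRing_invariants hdim hell hd hx
  have : IsNoetherianRing B := Algebra.FiniteType.isNoetherianRing k B
  have : Infinite k := IsAlgClosed.instInfinite
  have htrdeg : Algebra.trdeg k (invariants ρ) ≤ 1 :=
    (trdeg_le_of_injective
      (IsScalarTower.toAlgHom k (invariants ρ) (invariantField (fractionAction L ρ)))
      (FaithfulSMul.algebraMap_injective _ _)).trans (trdeg_invariantField_le_one hdim hd hx)
  exact (isDedekindDomain_iff _ (invariantField (fractionAction L ρ))).mpr
    ⟨inferInstance, isNoetherianRing_invariants hρ, dimensionLEOne_of_trdeg_le_one (k := k) htrdeg,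
      exists_algebraMap_invariants_eq_of_isIntegral⟩

end InvariantCurve

section LaurentAlgebra

variable {k B L : Type*} [Field k] [CommRing B] [Algebra k B] [Field L] [Algebra B L]
  [IsFractionRing B L] [Algebra k L] [IsScalarTower k B L]
  {ρ : kˣ →* (B ≃ₐ[k] B)} {x : Lˣ} {d : ℤ}

variable (ρ x) in
/-- The Laurent polynomials over the field of invariants whose value at `x` lies in `B`. If the
weight of `x` is nonzero and divides all weights of `B`, this is `B`, graded by the weights divided
by that of `x`. -/
def laurentAlgebra : Subalgebra (invariants ρ)
    (AddMonoidAlgebra (invariantField (fractionAction L ρ)) ℤ) :=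
  (IsScalarTower.toAlgHom (invariants ρ) B L).range.comap
    ((laurentEval (fractionAction L ρ) x).restrictScalars (invariants ρ))

theorem mem_laurentAlgebra {F : AddMonoidAlgebra (invariantField (fractionAction L ρ)) ℤ} :
    F ∈ laurentAlgebra ρ x ↔ ∃ b, algebraMap B L b = laurentEval (fractionAction L ρ) x F :=
  Iff.rfl

theorem isRootClosed_laurentAlgebra [IsIntegrallyClosed B] :
    IsRootClosed (laurentAlgebra (L := L) ρ x) := by
  rintro N m f hN ⟨b, hb⟩
  have hpow : algebraMap B L b = (laurentEval (fractionAction L ρ) x (.single m f)) ^ N := by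
    rw [← map_pow, AddMonoidAlgebra.single_pow]
    exact hb
  have hint : IsIntegral B (laurentEval (fractionAction L ρ) x (.single m f)) :=
    IsIntegral.of_pow hN (hpow ▸ isIntegral_algebraMap)
  exact IsIntegrallyClosed.isIntegral_iff.mp hint

theorem exists_laurentEval_eq_of_mem_weightSpace (hx : (x : L) ∈ weightSpace (fractionAction L ρ) d)
    {j : ℤ} {b : B} (hb : b ∈ weightSpace ρ (j * d)) :
    ∃ f, laurentEval (fractionAction L ρ) x (.single j f) = algebraMap B L b := by
  have hf : algebraMap B L b * (x : L) ^ (-j) ∈ weightSpace (fractionAction L ρ) 0 := by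
    rw [← add_neg_cancel (j * d), ← neg_mul]
    exact SetLike.GradedMul.mul_mem (algebraMap_mem_weightSpace_iff.mpr hb)
      (zpow_mem_weightSpace hx (-j))
  refine ⟨⟨_, hf⟩, ?_⟩
  rw [laurentEval_single, mul_assoc, ← zpow_add₀ x.ne_zero, neg_add_cancel, zpow_zero, mul_one]

variable [Infinite k]

theorem exists_laurentEval_eq (hρ : IsAlgebraicAction ρ)
    (hx : (x : L) ∈ weightSpace (fractionAction L ρ) d)
    (hdvd : ∀ m, ∀ b ∈ weightSpace ρ m, b ≠ 0 → d ∣ m) (b : B) :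
    ∃ F, laurentEval (fractionAction L ρ) x F = algebraMap B L b ∧
      ∀ m, .single m (F.coeff m) ∈ laurentAlgebra ρ x := by
  induction (iSup_weightSpace hρ ▸ Submodule.mem_top : b ∈ ⨆ m, weightSpace ρ m)
    using Submodule.iSup_induction' with
  | mem m b hb =>
    rcases eq_or_ne b 0 with rfl | hb0
    · exact ⟨0, by simp⟩
    obtain ⟨j, rfl⟩ := hdvd m b hb hb0
    obtain ⟨f, hf⟩ := exists_laurentEval_eq_of_mem_weightSpace hx (mul_comm d j ▸ hb)
    refine ⟨.single j f, hf, fun i => ?_⟩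
    rw [AddMonoidAlgebra.coeff_single, Finsupp.single_apply]
    split_ifs with h
    · exact h ▸ ⟨b, hf.symm⟩
    · simp
  | zero => exact ⟨0, by simp⟩
  | add b c _ _ hb hc =>
    obtain ⟨F, hF, hFmem⟩ := hb
    obtain ⟨G, hG, hGmem⟩ := hc
    refine ⟨F + G, by rw [map_add, hF, hG, map_add], fun m => ?_⟩
    rw [AddMonoidAlgebra.coeff_add, Finsupp.add_apply, AddMonoidAlgebra.single_add]
    exact add_mem (hFmem m) (hGmem m)

theorem single_coeff_mem_laurentAlgebra (hρ : IsAlgebraicAction ρ) (hd : d ≠ 0)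
    (hx : (x : L) ∈ weightSpace (fractionAction L ρ) d)
    (hdvd : ∀ m, ∀ b ∈ weightSpace ρ m, b ≠ 0 → d ∣ m)
    {F : AddMonoidAlgebra (invariantField (fractionAction L ρ)) ℤ} (hF : F ∈ laurentAlgebra ρ x)
    (m : ℤ) : .single m (F.coeff m) ∈ laurentAlgebra ρ x := by
  obtain ⟨b, hb⟩ := mem_laurentAlgebra.mp hF
  obtain ⟨G, hG, hmem⟩ := exists_laurentEval_eq hρ hx hdvd b
  rw [laurentEval_injective hd hx (hb.symm.trans hG.symm)]
  exact hmem m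

theorem exists_ringEquiv_laurentAlgebra (hρ : IsAlgebraicAction ρ) (hd : d ≠ 0)
    (hx : (x : L) ∈ weightSpace (fractionAction L ρ) d)
    (hdvd : ∀ m, ∀ b ∈ weightSpace ρ m, b ≠ 0 → d ∣ m) :
    ∃ e : laurentAlgebra ρ x ≃+* B,
      ∀ F, algebraMap B L (e F) = laurentEval (fractionAction L ρ) x F := by
  have hB := IsFractionRing.injective B L
  let ev : laurentAlgebra ρ x →+* (algebraMap B L).range :=
    ((laurentEval (fractionAction L ρ) x).toRingHom.comp
      (laurentAlgebra ρ x).subtype).codRestrict _ fun F => mem_laurentAlgebra.mp F.2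
  have hev : Function.Bijective ev := by
    refine ⟨fun F G h => Subtype.ext (laurentEval_injective hd hx (congrArg Subtype.val h)), ?_⟩
    rintro ⟨_, b, rfl⟩
    obtain ⟨F, hF, -⟩ := exists_laurentEval_eq hρ hx hdvd b
    exact ⟨⟨F, b, hF.symm⟩, Subtype.ext hF⟩
  let toRange := RingEquiv.ofBijective (algebraMap B L).rangeRestrict
    ⟨fun _ _ h => hB (congrArg Subtype.val h), (algebraMap B L).rangeRestrict_surjective⟩
  exact ⟨(RingEquiv.ofBijective ev hev).trans toRange.symm, fun F =>
    congrArg Subtype.val (toRange.apply_symm_apply (ev F))⟩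

theorem isHomogeneous_map_symm [GradedRing (gradedPiece (laurentAlgebra (L := L) ρ x))]
    (hd : d ≠ 0) (hx : (x : L) ∈ weightSpace (fractionAction L ρ) d) {J : Ideal B}
    (hJ : ∀ t : kˣ, ∀ b ∈ J, ρ t b ∈ J) {e : laurentAlgebra ρ x ≃+* B}
    (he : ∀ F, algebraMap B L (e F) = laurentEval (fractionAction L ρ) x F) :
    (J.map (e.symm : B →+* laurentAlgebra ρ x)).IsHomogeneous
      (gradedPiece (laurentAlgebra ρ x)) := by
  classical
  have hmem (F) : F ∈ J.map (e.symm : B →+* laurentAlgebra ρ x) ↔ e F ∈ J := by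
    change F ∈ J.map e.symm ↔ _
    rw [Ideal.map_symm, Ideal.mem_comap]
  intro m F hF
  let c := DirectSum.decompose (gradedPiece (laurentAlgebra ρ x)) F
  have hsum : ∑ i ∈ c.support, e (c i) ∈ J := by
    rw [← map_sum, DirectSum.sum_support_decompose]
    exact (hmem F).mp hF
  have hweight (i : ℤ) : e (c i) ∈ weightSpace ρ (i * d) := by
    obtain ⟨f, hf⟩ := mem_gradedPiece.mp (c i).2
    rw [← algebraMap_mem_weightSpace_iff (L := L), he, hf]
    exact laurentEval_single_mem_weightSpace hx i f
  rw [hmem]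
  by_cases hm : m ∈ c.support
  · exact mem_of_sum_mem_of_stable hJ (mul_left_injective₀ hd) (fun i _ => hweight i) hsum m hm
  · change e (c m) ∈ J
    rw [DFinsupp.notMem_support_iff.mp hm]
    simp

end LaurentAlgebra

section Surface

theorem isNormalIdeal_of_stable {k B : Type*} [Field k] [IsAlgClosed k] [CommRing B] [Algebra k B]
    [IsDomain B] [IsIntegrallyClosed B] [Algebra.FiniteType k B] (hdim : ringKrullDim B = 2)
    {ρ : kˣ →* (B ≃ₐ[k] B)} (hρ : IsAlgebraicAction ρ) (hρ1 : ρ ≠ 1) (hell : ¬ IsElliptic ρ)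
    {J : Ideal B} (hJ : ∀ t : kˣ, ∀ b ∈ J, ρ t b ∈ J) (hJc : IsIntegrallyClosedIdeal J) :
    IsNormalIdeal J := by
  have : Infinite k := IsAlgClosed.instInfinite
  obtain ⟨d, x, hx, hdvd⟩ := exists_mem_weightSpace_forall_dvd (fractionAction (FractionRing B) ρ)
  have hdvd (m : ℤ) (b : B) (hb : b ∈ weightSpace ρ m) (hb0 : b ≠ 0) : d ∣ m :=
    hdvd m _ (algebraMap_mem_weightSpace_iff.mpr hb)
      ((map_ne_zero_iff _ (IsFractionRing.injective B (FractionRing B))).mpr hb0)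
  have hd : d ≠ 0 := fun hd => hρ1 <| eq_one_of_forall_mem_weightSpace_eq_zero hρ
    fun m b hb hb0 => zero_dvd_iff.mp (hd ▸ hdvd m b hb hb0)
  obtain ⟨e, he⟩ := exists_ringEquiv_laurentAlgebra hρ hd hx hdvd
  have := isDedekindDomain_invariants hdim hρ hell hd hx
  have := isFractionRing_invariants hdim hell hd hx
  let := gradedRingOfSingleCoeffMem fun F (hF : F ∈ laurentAlgebra ρ x) m =>
    single_coeff_mem_laurentAlgebra hρ hd hx hdvd hF m
  have h := isNormalIdeal_idealClosure_pow (e := 1) (not_isField_invariants hell)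
    isRootClosed_laurentAlgebra (isHomogeneous_map_symm hd hx hJ he) (by simp)
  rw [pow_one, (hJc.map_equiv e.symm).idealClosure_eq] at h
  have hJnormal := h.map_equiv e
  rwa [Ideal.map_map, RingEquiv.comp_symm, Ideal.map_id] at hJnormal

end Surface

end ComplexityOne

end

theorem mainTheorem5_general :
    (∀ (R : Type*) [CommRing R] [IsDedekindDomain R] (_ : ¬ IsField R)
      (K : Type*) [Field K] [Algebra R K] [IsFractionRing R K]
      (ι : Type*) [Fintype ι] (σ : PointedCone ℚ (ι → ℚ)) (D : PolyhedralDivisor R σ)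
      (I : Ideal (D.algebra K)), D.IsHomogeneousIdeal K I →
      (∀ (P : Set (ι → ℚ)) (D' : PolyhedralDivisor R (dualCone (reesCone σ P))),
        D.IsAssociatedPair K I P D' →
        (∀ z ∈ D'.support, IsNormalPolyhedron (D'.localPolyhedron P z)) →
        (D'.support = ∅ → IsNormalPolyhedron P) →
        IsNormalIdeal I) ∧
      (∀ e : ℕ, Fintype.card ι ≤ e → IsNormalIdeal (idealClosure (I ^ e)))) ∧
    (∀ (k : Type*) [Field k] [IsAlgClosed k]
      (B : Type*) [CommRing B] [IsDomain B] [IsIntegrallyClosed B] [Algebra k B]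
      [Algebra.FiniteType k B] (_ : ringKrullDim B = 2)
      (ρ : kˣ →* (B ≃ₐ[k] B)) (_ : IsAlgebraicAction ρ) (_ : ρ ≠ 1)
      (_ : ¬ IsElliptic ρ) (J : Ideal B) (_ : ∀ t : kˣ, ∀ b ∈ J, ρ t b ∈ J),
      IsIntegrallyClosedIdeal J → IsNormalIdeal J) :=
  ⟨fun _ _ _ hR _ _ _ _ _ _ _ _ _ hI =>
    ⟨fun _ _ h hsupp hempty =>
      h.isNormalIdeal hR hI (h.isNormalPolyhedron_localPolyhedron hsupp hempty),
    fun _ he => hI.isNormalIdeal_idealClosure_pow hR he⟩,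
  fun _ _ _ _ _ _ _ _ _ hdim _ hρ hρ1 hell _ hJ hJc =>
    isNormalIdeal_of_stable hdim hρ hρ1 hell hJ hJc⟩

theorem mainTheorem5 (k : Type*) [Field k] [IsAlgClosed k] [CharZero k] :
    (∀ (R : Type*) [CommRing R] [IsDedekindDomain R] [Algebra k R] [Algebra.FiniteType k R]
      (_ : ¬ IsField R) (K : Type*) [Field K] [Algebra R K] [IsFractionRing R K]
      (n : ℕ) (σ : PointedCone ℚ (Fin n → ℚ)) (_ : σ.FG)
      (_ : (σ : ConvexCone ℚ (Fin n → ℚ)).Salient)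
      (D : PolyhedralDivisor R σ) (I : Ideal (D.algebra K)),
      D.IsHomogeneousIdeal K I → IsIntegrallyClosedIdeal I →
      (∀ (P : Set (Fin n → ℚ)) (D' : PolyhedralDivisor R (dualCone (reesCone σ P))),
        D.IsAssociatedPair K I P D' →
        (∀ z ∈ D'.support, IsNormalPolyhedron (D'.localPolyhedron P z)) →
        (D'.support = ∅ → IsNormalPolyhedron P) →
        IsNormalIdeal I) ∧
      (∀ e : ℕ, n ≤ e → IsNormalIdeal (idealClosure (I ^ e)))) ∧
    (∀ (B : Type*) [CommRing B] [IsDomain B] [IsIntegrallyClosed B] [Algebra k B]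
      [Algebra.FiniteType k B] (_ : ringKrullDim B = 2)
      (ρ : kˣ →* (B ≃ₐ[k] B)) (_ : IsAlgebraicAction ρ) (_ : Function.Injective ρ)
      (_ : ¬ IsElliptic ρ) (J : Ideal B) (_ : ∀ t : kˣ, ∀ b ∈ J, ρ t b ∈ J),
      IsIntegrallyClosedIdeal J → IsNormalIdeal J) :=
  mainTheorem5_general.imp
    (fun h R _ _ _ _ hR K _ _ _ n σ _ _ D I hI _ => by
      simpa only [Fintype.card_fin] using h R hR K (Fin n) σ D I hI)
    fun h B _ _ _ _ _ hdim ρ hρ hinj => h k B hdim ρ hρ fun hρ1 => by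
      have : Infinite k := IsAlgClosed.instInfinite
      exact one_ne_zero (eq_zero_of_forall_units_zpow_eq_one (k := k) fun t => hinj (by simp [hρ1]))
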